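/- Let $A$ be a C*-algebra, and let $\mathcal K$ be the C*-algebra of compact operators on a separable infinite-dimensional Hilbert space. Identify $A$ with the top left corner of $A\otimes\mathcal K$, and let $(A\otimes\mathcal K)^\sim$ be the unitization of $A\otimes\mathcal K$. Elements $a,b\in A$ are called stably approximately unitarily equivalent if there are unitaries $u_n\in(A\otimes\mathcal K)^\sim$, $n=1,2,\dots$, such that $u_n^*au_n\to b$. Homomorphisms $\phi,\psi\colon C_0(0,1]\to A$ (that is, $*$-homomorphisms) are called stably approximately unitarily equivalent if there are unitaries $u_n\in(A\otimes\mathcal K)^\sim$, $n=1,2,\dots$, such that $u_n\phi(f)u_n^*\to\psi(f)$ for every $f\in C_0(0,1]$. For positive elements $a,b$ of a C*-algebra $B$ write $a\preccurlyeq_{Cu}b$ if there are $d_n\in B$ with $d_n^*bd_n\to a$. Let $\mathrm{Cu}(A)$ be the set of classes $[a]$ of positive elements $a\in A\otimes\mathcal K$ modulo the equivalence relation $a\preccurlyeq_{Cu}b\preccurlyeq_{Cu}a$, ordered by $[a]\le[b]$ if $a\preccurlyeq_{Cu}b$ in $A\otimes\mathcal K$. A homomorphism $\phi\colon C_0(0,1]\to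 A$ induces the order-preserving map $\mathrm{Cu}(\phi)\colon\mathrm{Cu}(C_0(0,1])\to\mathrm{Cu}(A)$, $[a]\mapsto[(\phi\otimes\mathrm{id}_{\mathcal K})(a)]$. For $t\ge0$ let $e_t\in C_0(0,1]$ be the function $e_t(x)=\max(x-t,0)$, and let $\mathrm{id}\in C_0(0,1]$ be the function $\mathrm{id}(x)=x$. For order-preserving maps $\alpha,\beta\colon\mathrm{Cu}(C_0(0,1])\to\mathrm{Cu}(A)$ put $$d_W(\alpha,\beta)=\inf\{r\ge0 : \alpha([e_{t+r}])\le\beta([e_t])\text{ and }\beta([e_{t+r}])\le\alpha([e_t])\text{ for all }t\ge0\},$$ and for homomorphisms $\phi,\psi\colon C_0(0,1]\to A$ put $d_W(\phi,\psi)=d_W(\mathrm{Cu}(\phi),\mathrm{Cu}(\psi))$ and $$d_U(\phi,\psi)=\inf\{\|u\,\phi(\mathrm{id})\,u^*-v\,\psi(\mathrm{id})\,v^*\| : u,v\text{ unitaries in }(A\otimes\mathcal K)^\sim\}.$$ Then the following two properties of $A$ are equivalent. (I) For all $x,e\in A$ such that $e$ is a positive contraction and $ex=xe=x$, the element $x^*x+e$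 is stably approximately unitarily equivalent to $xx^*+e$. (II) For all homomorphisms $\phi,\psi\colon C_0(0,1]\to A$ with $d_W(\mathrm{Cu}(\phi),\mathrm{Cu}(\psi))=0$, $\phi$ is stably approximately unitarily equivalent to $\psi$. Moreover, if (I) and (II) hold, then for all homomorphisms $\phi,\psi\colon C_0(0,1]\to A$, $$d_W(\phi,\psi)\le d_U(\phi,\psi)\le4\,d_W(\phi,\psi).$$ -/

import Mathlib

noncomputable section

open Filter Topology

namespace StableCu

universe u v

/-! ## The stabilization `A ⊗ 𝓚` -/

section FiniteMatrices

attribute [local instance] CStarAlgebra.spectralOrder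
attribute [local instance] CStarAlgebra.spectralOrderedRing

variable (A : Type u) [NonUnitalCStarAlgebra A] {B : Type v} [NonUnitalCStarAlgebra B]

/-- The C*-algebra `M_n(A)`. -/
abbrev Mat (n : ℕ) : Type u := CStarMatrix (Fin n) (Fin n) A

variable {A}

/-- The underlying function of the embedding of `M_m(A)` in `M_n(A)` as the top left corner. -/
def padFun {m : ℕ} (n : ℕ) (M : Mat A m) : Mat A n :=
  CStarMatrix.ofMatrix fun i j =>
    if hi : (i : ℕ) < m then if hj : (j : ℕ) < m then M ⟨i, hi⟩ ⟨j, hj⟩ else 0 else 0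

lemma padFun_apply {m n : ℕ} (M : Mat A m) (i j : Fin n) :
    padFun n M i j =
      if hi : (i : ℕ) < m then if hj : (j : ℕ) < m then M ⟨i, hi⟩ ⟨j, hj⟩ else 0 else 0 := rfl

/-- The embedding of `M_m(A)` in `M_n(A)`, for `m ≤ n`, as the top left corner. -/
def pad (m n : ℕ) (h : m ≤ n) : Mat A m →⋆ₙₐ[ℂ] Mat A n where
  toFun := padFun n
  map_smul' c M := by
    ext i j
    simp only [CStarMatrix.smul_apply, padFun_apply, MonoidHom.id_apply]
    split_ifs <;> simp
  map_zero' := by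
    ext i j
    simp [padFun_apply]
  map_add' M N := by
    ext i j
    simp only [CStarMatrix.add_apply, padFun_apply]
    split_ifs <;> simp
  map_mul' M N := by
    ext i j
    simp only [CStarMatrix.mul_apply, padFun_apply]
    by_cases hi : (i : ℕ) < m
    · by_cases hj : (j : ℕ) < m
      · simp only [hi, hj, dite_true]
        refine Fintype.sum_of_injective (Fin.castLE h) (Fin.castLE_injective h) _ _ ?_ ?_
        · intro k hk
          have : ¬ (k : ℕ) < m := fun hk' => hk ⟨⟨k, hk'⟩, by ext; simp⟩
          simp [this]
        · intro k
          simp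
      · simp [hj]
    · simp [hi]
  map_star' M := by
    ext i j
    simp only [CStarMatrix.star_apply, padFun_apply]
    split_ifs <;> simp

lemma pad_apply {m n : ℕ} (h : m ≤ n) (M : Mat A m) (i j : Fin n) :
    pad m n h M i j =
      if hi : (i : ℕ) < m then if hj : (j : ℕ) < m then M ⟨i, hi⟩ ⟨j, hj⟩ else 0 else 0 := rfl

lemma pad_injective {m n : ℕ} (h : m ≤ n) : Function.Injective (pad (A := A) m n h) := by
  intro M N hMN
  ext i j
  have := congrArg (fun X : Mat A n => X (Fin.castLE h i) (Fin.castLE h j)) hMN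
  simpa [pad_apply] using this

instance directedSystem_pad :
    DirectedSystem (Mat A) (fun m n (h : m ≤ n) => (pad (A := A) m n h : Mat A m → Mat A n)) where
  map_self m M := by
    ext i j
    simp [pad_apply]
  map_map k j i hij hjk M := by
    ext a b
    simp only [pad_apply]
    by_cases ha : (a : ℕ) < i
    · by_cases hb : (b : ℕ) < i
      · simp [ha, hb, ha.trans_le hij, hb.trans_le hij]
      · simp [hb]
    · simp [ha]

variable (A)

/-- The *-algebra `M_∞(A) = ⋃ₙ M_n(A)`, the algebraic direct limit of the embeddings
of `M_m(A)` in `M_n(A)` as the top left corner. -/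
def FinMat : Type u := DirectLimit (Mat A) (pad (A := A))

instance : NonUnitalRing (FinMat A) :=
  inferInstanceAs (NonUnitalRing (DirectLimit (Mat A) (pad (A := A))))

instance : SMul ℂ (FinMat A) :=
  inferInstanceAs (SMul ℂ (DirectLimit (Mat A) (pad (A := A))))

instance : Star (FinMat A) :=
  inferInstanceAs (Star (DirectLimit (Mat A) (pad (A := A))))

variable {A}

/-- The element of `M_∞(A)` given by an `n × n` matrix. -/
def FinMat.mk (n : ℕ) (M : Mat A n) : FinMat A :=
  (⟦⟨n, M⟩⟧ : DirectLimit (Mat A) (pad (A := A)))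

lemma FinMat.exists_mk (x : FinMat A) : ∃ n M, x = FinMat.mk n M :=
  DirectLimit.exists_eq_mk (pad (A := A)) x

lemma FinMat.exists_mk₂ (x y : FinMat A) : ∃ n M N, x = FinMat.mk n M ∧ y = FinMat.mk n N :=
  DirectLimit.exists_eq_mk₂ (pad (A := A)) x y

lemma FinMat.mk_zero (n : ℕ) : FinMat.mk n (0 : Mat A n) = 0 :=
  (DirectLimit.zero_def (f := pad (A := A)) n).symm

lemma FinMat.mk_add (n : ℕ) (M N : Mat A n) :
    FinMat.mk n (M + N) = FinMat.mk n M + FinMat.mk n N :=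
  (DirectLimit.add_def (f := pad (A := A)) ..).symm

lemma FinMat.mk_mul (n : ℕ) (M N : Mat A n) :
    FinMat.mk n (M * N) = FinMat.mk n M * FinMat.mk n N :=
  (DirectLimit.mul_def (f := pad (A := A)) ..).symm

lemma FinMat.mk_smul (n : ℕ) (c : ℂ) (M : Mat A n) :
    FinMat.mk n (c • M) = c • FinMat.mk n M := rfl

lemma FinMat.mk_star (n : ℕ) (M : Mat A n) :
    FinMat.mk n (star M) = star (FinMat.mk n M) := rfl

variable (A)

instance : Module ℂ (FinMat A) where
  one_smul x := by
    obtain ⟨n, M, rfl⟩ := x.exists_mk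
    rw [← FinMat.mk_smul, one_smul]
  mul_smul c d x := by
    obtain ⟨n, M, rfl⟩ := x.exists_mk
    rw [← FinMat.mk_smul, ← FinMat.mk_smul, ← FinMat.mk_smul, mul_smul]
  smul_zero c := by rw [← FinMat.mk_zero 0, ← FinMat.mk_smul, smul_zero]
  smul_add c x y := by
    obtain ⟨n, M, N, rfl, rfl⟩ := x.exists_mk₂ y
    rw [← FinMat.mk_add, ← FinMat.mk_smul, ← FinMat.mk_smul, ← FinMat.mk_smul, ← FinMat.mk_add,
      smul_add]
  add_smul c d x := by
    obtain ⟨n, M, rfl⟩ := x.exists_mk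
    rw [← FinMat.mk_smul, ← FinMat.mk_smul, ← FinMat.mk_smul, ← FinMat.mk_add, add_smul]
  zero_smul x := by
    obtain ⟨n, M, rfl⟩ := x.exists_mk
    rw [← FinMat.mk_smul, zero_smul, FinMat.mk_zero]

instance : StarRing (FinMat A) where
  star_involutive x := by
    obtain ⟨n, M, rfl⟩ := x.exists_mk
    rw [← FinMat.mk_star, ← FinMat.mk_star, star_star]
  star_mul x y := by
    obtain ⟨n, M, N, rfl, rfl⟩ := x.exists_mk₂ y
    rw [← FinMat.mk_mul, ← FinMat.mk_star, ← FinMat.mk_star, ← FinMat.mk_star, ← FinMat.mk_mul,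
      star_mul]
  star_add x y := by
    obtain ⟨n, M, N, rfl, rfl⟩ := x.exists_mk₂ y
    rw [← FinMat.mk_add, ← FinMat.mk_star, ← FinMat.mk_star, ← FinMat.mk_star, ← FinMat.mk_add,
      star_add]

instance : StarModule ℂ (FinMat A) where
  star_smul c x := by
    obtain ⟨n, M, rfl⟩ := x.exists_mk
    rw [← FinMat.mk_smul, ← FinMat.mk_star, ← FinMat.mk_star, ← FinMat.mk_smul, star_smul]

instance : IsScalarTower ℂ (FinMat A) (FinMat A) where
  smul_assoc c x y := by
    obtain ⟨n, M, N, rfl, rfl⟩ := x.exists_mk₂ y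
    simp only [smul_eq_mul]
    rw [← FinMat.mk_smul, ← FinMat.mk_mul, ← FinMat.mk_mul, ← FinMat.mk_smul, smul_mul_assoc]

instance : SMulCommClass ℂ (FinMat A) (FinMat A) where
  smul_comm c x y := by
    obtain ⟨n, M, N, rfl, rfl⟩ := x.exists_mk₂ y
    simp only [smul_eq_mul]
    rw [← FinMat.mk_smul, ← FinMat.mk_mul, ← FinMat.mk_mul, ← FinMat.mk_smul, mul_smul_comm]

/-- The canonical embedding of `M_n(A)` in `M_∞(A)`. -/
def FinMat.of (n : ℕ) : Mat A n →⋆ₙₐ[ℂ] FinMat A where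
  toFun := FinMat.mk n
  map_smul' _ _ := rfl
  map_zero' := FinMat.mk_zero n
  map_add' := FinMat.mk_add n
  map_mul' := FinMat.mk_mul n
  map_star' _ := rfl

/-- The norm of `M_∞(A)`: the common value of the C*-norms of all the `M_n(A)` that contain
the given element. -/
instance : Norm (FinMat A) where
  norm x := DirectLimit.lift (pad (A := A)) (fun _ M => ‖M‖)
    (fun m n h M => (NonUnitalStarAlgHom.norm_map (pad m n h) (pad_injective h) M).symm) x

variable {A}

lemma FinMat.norm_of (n : ℕ) (M : Mat A n) : ‖FinMat.of A n M‖ = ‖M‖ := rfl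

lemma FinMat.of_pad {m n : ℕ} (h : m ≤ n) (M : Mat A m) :
    FinMat.of A n (pad m n h M) = FinMat.of A m M :=
  DirectLimit.mk_apply (f := pad (A := A)) m n M h

lemma FinMat.exists_of (x : FinMat A) : ∃ n M, x = FinMat.of A n M :=
  DirectLimit.exists_eq_mk (pad (A := A)) x

lemma FinMat.exists_of₂ (x y : FinMat A) : ∃ n M N, x = FinMat.of A n M ∧ y = FinMat.of A n N :=
  DirectLimit.exists_eq_mk₂ (pad (A := A)) x y

variable (A)

lemma FinMat.normCore : NormedSpace.Core ℂ (FinMat A) where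
  norm_nonneg x := by
    obtain ⟨n, M, rfl⟩ := x.exists_of
    exact norm_nonneg M
  norm_smul c x := by
    obtain ⟨n, M, rfl⟩ := x.exists_of
    rw [← map_smul, FinMat.norm_of, FinMat.norm_of, norm_smul]
  norm_triangle x y := by
    obtain ⟨n, M, N, rfl, rfl⟩ := x.exists_of₂ y
    rw [← map_add, FinMat.norm_of, FinMat.norm_of, FinMat.norm_of]
    exact norm_add_le M N
  norm_eq_zero_iff x := by
    obtain ⟨n, M, rfl⟩ := x.exists_of
    constructor
    · intro h
      rw [FinMat.norm_of, norm_eq_zero] at h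
      rw [h, map_zero]
    · intro h
      have h0 : ‖FinMat.of A n 0‖ = 0 := by rw [FinMat.norm_of, norm_zero]
      rwa [map_zero, ← h] at h0

instance : NonUnitalNormedRing (FinMat A) where
  __ := (inferInstance : NonUnitalRing (FinMat A))
  __ := NormedAddCommGroup.ofCore (FinMat.normCore A)
  norm_mul_le x y := by
    obtain ⟨n, M, N, rfl, rfl⟩ := x.exists_of₂ y
    rw [← map_mul, FinMat.norm_of, FinMat.norm_of, FinMat.norm_of]
    exact norm_mul_le M N

instance : NormedSpace ℂ (FinMat A) := NormedSpace.ofCore (FinMat.normCore A)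

instance : CStarRing (FinMat A) where
  norm_mul_self_le x := by
    obtain ⟨n, M, rfl⟩ := x.exists_of
    rw [← map_star, ← map_mul, FinMat.norm_of, FinMat.norm_of]
    exact CStarRing.norm_mul_self_le M

variable {A}

/-- The *-homomorphism `M_∞(A) → M_∞(B)` that applies a *-homomorphism `A → B` to the entries. -/
def FinMat.map (φ : A →⋆ₙₐ[ℂ] B) : FinMat A →⋆ₙₐ[ℂ] FinMat B where
  toFun := DirectLimit.map (pad (A := A)) (pad (A := B)) (fun _ M => CStarMatrix.mapₙₐ φ M)
    (fun m n h M => by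
      ext i j
      simp only [pad_apply, CStarMatrix.mapₙₐ_apply, CStarMatrix.mapₗ_apply,
        CStarMatrix.map_apply]
      split_ifs <;> simp)
  map_smul' c x := by
    obtain ⟨n, M, rfl⟩ := x.exists_of
    exact congrArg (FinMat.of B n) (map_smul (CStarMatrix.mapₙₐ φ) c M)
  map_zero' := by
    rw [← map_zero (FinMat.of A 0), ← map_zero (FinMat.of B 0)]
    exact congrArg (FinMat.of B 0) (map_zero (CStarMatrix.mapₙₐ φ))
  map_add' x y := by
    obtain ⟨n, M, N, rfl, rfl⟩ := x.exists_of₂ y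
    rw [← map_add]
    exact (congrArg (FinMat.of B n) (map_add (CStarMatrix.mapₙₐ φ) M N)).trans
      (map_add (FinMat.of B n) _ _)
  map_mul' x y := by
    obtain ⟨n, M, N, rfl, rfl⟩ := x.exists_of₂ y
    rw [← map_mul]
    exact (congrArg (FinMat.of B n) (map_mul (CStarMatrix.mapₙₐ φ) M N)).trans
      (map_mul (FinMat.of B n) _ _)
  map_star' x := by
    obtain ⟨n, M, rfl⟩ := x.exists_of
    exact congrArg (FinMat.of B n) (map_star (CStarMatrix.mapₙₐ φ) M)

lemma FinMat.map_of (φ : A →⋆ₙₐ[ℂ] B) (n : ℕ) (M : Mat A n) :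
    FinMat.map φ (FinMat.of A n M) = FinMat.of B n (CStarMatrix.mapₙₐ φ M) := rfl

lemma FinMat.norm_map_le (φ : A →⋆ₙₐ[ℂ] B) (x : FinMat A) : ‖FinMat.map φ x‖ ≤ ‖x‖ := by
  obtain ⟨n, M, rfl⟩ := x.exists_of
  rw [FinMat.map_of, FinMat.norm_of, FinMat.norm_of]
  exact NonUnitalStarAlgHom.norm_apply_le (CStarMatrix.mapₙₐ φ) M

end FiniteMatrices

section Stabilization

open UniformSpace

variable (A : Type u) [NonUnitalCStarAlgebra A] {B : Type v} [NonUnitalCStarAlgebra B]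

/-- The stabilization `A ⊗ 𝓚` of `A`, where `𝓚` is the algebra of compact operators on a
separable infinite dimensional Hilbert space: the C*-algebra completion of `M_∞(A)`. -/
def Stab : Type u := Completion (FinMat A)

instance : NormedAddCommGroup (Stab A) := inferInstanceAs (NormedAddCommGroup (Completion (FinMat A)))
instance : NormedSpace ℂ (Stab A) := inferInstanceAs (NormedSpace ℂ (Completion (FinMat A)))
instance : CompleteSpace (Stab A) := inferInstanceAs (CompleteSpace (Completion (FinMat A)))

variable {A}

/-- The inclusion of `M_∞(A)` in `A ⊗ 𝓚`. -/
def toStab (x : FinMat A) : Stab A := (x : Completion (FinMat A))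

lemma isDenseInducing_toStab : IsDenseInducing (toStab (A := A)) :=
  Completion.isDenseInducing_coe (α := FinMat A)

lemma continuous_toStab : Continuous (toStab (A := A)) := isDenseInducing_toStab.continuous

lemma norm_toStab (x : FinMat A) : ‖toStab x‖ = ‖x‖ := Completion.norm_coe x

lemma toStab_add (x y : FinMat A) : toStab (x + y) = toStab x + toStab y := Completion.coe_add x y

lemma toStab_zero : toStab (0 : FinMat A) = 0 := rfl

lemma toStab_smul (c : ℂ) (x : FinMat A) : toStab (c • x) = c • toStab x := Completion.coe_smul c x

@[elab_as_elim]
lemma Stab.induction_on {p : Stab A → Prop} (x : Stab A) (hp : IsClosed {x | p x})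
    (ih : ∀ x : FinMat A, p (toStab x)) : p x :=
  Completion.induction_on (α := FinMat A) x hp ih

@[elab_as_elim]
lemma Stab.induction_on₂ {p : Stab A → Stab A → Prop} (x y : Stab A)
    (hp : IsClosed {z : Stab A × Stab A | p z.1 z.2})
    (ih : ∀ x y : FinMat A, p (toStab x) (toStab y)) : p x y :=
  Completion.induction_on₂ (α := FinMat A) (β := FinMat A) x y hp ih

@[elab_as_elim]
lemma Stab.induction_on₃ {p : Stab A → Stab A → Stab A → Prop} (x y z : Stab A)
    (hp : IsClosed {w : Stab A × Stab A × Stab A | p w.1 w.2.1 w.2.2})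
    (ih : ∀ x y z : FinMat A, p (toStab x) (toStab y) (toStab z)) : p x y z :=
  Completion.induction_on₃ (α := FinMat A) (β := FinMat A) (γ := FinMat A) x y z hp ih

/-- The multiplication of `A ⊗ 𝓚`, extended by continuity from `M_∞(A)`. -/
instance : Mul (Stab A) where
  mul x y := (isDenseInducing_toStab.prodMap isDenseInducing_toStab).extend
    (fun p : FinMat A × FinMat A => toStab (p.1 * p.2)) (x, y)

/-- The involution of `A ⊗ 𝓚`, extended by continuity from `M_∞(A)`. -/
instance : Star (Stab A) where
  star x := Completion.map (star : FinMat A → FinMat A) x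

lemma toStab_mul (x y : FinMat A) : toStab (x * y) = toStab x * toStab y :=
  ((isDenseInducing_toStab.prodMap isDenseInducing_toStab).extend_eq
    (continuous_toStab.comp (continuous_mul (M := FinMat A))) (x, y)).symm

lemma toStab_star (x : FinMat A) : toStab (star x) = star (toStab x) :=
  (Completion.map_coe (star_isometry (E := FinMat A)).uniformContinuous x).symm

instance : ContinuousMul (Stab A) where
  continuous_mul := by
    let m := (AddMonoidHom.mul : FinMat A →+ FinMat A →+ FinMat A).compr₂ Completion.toCompl
    have : Continuous fun p : FinMat A × FinMat A => m p.1 p.2 :=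
      (Completion.continuous_coe (FinMat A)).comp continuous_mul
    have di : IsDenseInducing (Completion.toCompl : FinMat A → Completion (FinMat A)) :=
      Completion.isDenseInducing_coe
    exact (di.extend_Z_bilin di this :)

lemma Stab.continuous_star : Continuous (star : Stab A → Stab A) :=
  Completion.continuous_map (α := FinMat A)

instance : ContinuousStar (Stab A) where
  continuous_star := Stab.continuous_star

lemma Stab.smul_mul (c : ℂ) (x y : Stab A) : (c • x) * y = c • (x * y) :=
  Stab.induction_on₂ x y
    (isClosed_eq (((continuous_const_smul c).comp continuous_fst).mul continuous_snd)
      ((continuous_const_smul c).comp continuous_mul))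
    fun x y => by rw [← toStab_smul, ← toStab_mul, ← toStab_mul, ← toStab_smul, smul_mul_assoc]

lemma Stab.mul_smul (c : ℂ) (x y : Stab A) : x * (c • y) = c • (x * y) :=
  Stab.induction_on₂ x y
    (isClosed_eq (continuous_fst.mul ((continuous_const_smul c).comp continuous_snd))
      ((continuous_const_smul c).comp continuous_mul))
    fun x y => by rw [← toStab_smul, ← toStab_mul, ← toStab_mul, ← toStab_smul, mul_smul_comm]

lemma Stab.star_smul' (c : ℂ) (x : Stab A) : star (c • x) = star c • star x :=
  Stab.induction_on x
    (isClosed_eq (Stab.continuous_star.comp (continuous_const_smul c))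
      ((continuous_const_smul (star c)).comp Stab.continuous_star))
    fun x => by rw [← toStab_smul, ← toStab_star, ← toStab_star, ← toStab_smul, star_smul]

instance : NonUnitalNormedRing (Stab A) where
  __ := (inferInstance : NormedAddCommGroup (Stab A))
  left_distrib x y z := Stab.induction_on₃ x y z (isClosed_eq (by fun_prop) (by fun_prop))
    fun x y z => by rw [← toStab_add, ← toStab_mul, ← toStab_mul, ← toStab_mul, ← toStab_add, mul_add]
  right_distrib x y z := Stab.induction_on₃ x y z (isClosed_eq (by fun_prop) (by fun_prop))
    fun x y z => by rw [← toStab_add, ← toStab_mul, ← toStab_mul, ← toStab_mul, ← toStab_add, add_mul]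
  zero_mul x := Stab.induction_on x (isClosed_eq (by fun_prop) (by fun_prop))
    fun x => by rw [← toStab_zero, ← toStab_mul, zero_mul]
  mul_zero x := Stab.induction_on x (isClosed_eq (by fun_prop) (by fun_prop))
    fun x => by rw [← toStab_zero, ← toStab_mul, mul_zero]
  mul_assoc x y z := Stab.induction_on₃ x y z (isClosed_eq (by fun_prop) (by fun_prop))
    fun x y z => by rw [← toStab_mul, ← toStab_mul, ← toStab_mul, ← toStab_mul, mul_assoc]
  norm_mul_le x y := Stab.induction_on₂ x y (isClosed_le (by fun_prop) (by fun_prop))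
    fun x y => by
      rw [← toStab_mul, norm_toStab, norm_toStab, norm_toStab]
      exact norm_mul_le x y

instance : StarRing (Stab A) where
  star_involutive x := Stab.induction_on x (isClosed_eq (by fun_prop) (by fun_prop))
    fun x => by rw [← toStab_star, ← toStab_star, star_star]
  star_mul x y := Stab.induction_on₂ x y (isClosed_eq (by fun_prop) (by fun_prop))
    fun x y => by rw [← toStab_mul, ← toStab_star, ← toStab_star, ← toStab_star, ← toStab_mul, star_mul]
  star_add x y := Stab.induction_on₂ x y (isClosed_eq (by fun_prop) (by fun_prop))
    fun x y => by rw [← toStab_add, ← toStab_star, ← toStab_star, ← toStab_star, ← toStab_add, star_add]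

instance : NonUnitalCStarAlgebra (Stab A) where
  norm_mul_self_le x := Stab.induction_on x (isClosed_le (by fun_prop) (by fun_prop))
    fun x => by
      rw [← toStab_star, ← toStab_mul, norm_toStab, norm_toStab]
      exact CStarRing.norm_mul_self_le x
  smul_assoc := Stab.smul_mul
  smul_comm c x y := (Stab.mul_smul c x y).symm
  star_smul := Stab.star_smul'

/-- The usual order of a C*-algebra. -/
instance : PartialOrder (Stab A) := CStarAlgebra.spectralOrder (Stab A)
instance : StarOrderedRing (Stab A) := CStarAlgebra.spectralOrderedRing (Stab A)

/-- The identification of `A` with `M_1(A)`. -/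
def oneByOne : A →⋆ₙₐ[ℂ] Mat A 1 where
  toFun a := CStarMatrix.ofMatrix fun _ _ => a
  map_smul' _ _ := rfl
  map_zero' := rfl
  map_add' _ _ := rfl
  map_mul' a b := by
    ext i j
    simp [CStarMatrix.mul_apply]
    rfl
  map_star' a := by
    ext i j
    simp [CStarMatrix.star_apply]
    rfl

/-- The identification of `A` with the top left corner of `A ⊗ 𝓚`. -/
def corner : A →⋆ₙₐ[ℂ] Stab A where
  toFun a := toStab (FinMat.of A 1 (oneByOne a))
  map_smul' c a := by rw [map_smul, map_smul, toStab_smul, MonoidHom.id_apply]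
  map_zero' := by rw [map_zero, map_zero, toStab_zero]
  map_add' a b := by rw [map_add, map_add, toStab_add]
  map_mul' a b := by rw [map_mul, map_mul, toStab_mul]
  map_star' a := by rw [map_star, map_star, toStab_star]

/-- The underlying function of `φ ⊗ id : A ⊗ 𝓚 → B ⊗ 𝓚`, the continuous extension of the
entrywise application of `φ`. -/
def Stab.mapFun (φ : A →⋆ₙₐ[ℂ] B) : Stab A → Stab B :=
  Completion.map (FinMat.map φ)

lemma Stab.continuous_mapFun (φ : A →⋆ₙₐ[ℂ] B) : Continuous (Stab.mapFun φ) :=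
  Completion.continuous_map (α := FinMat A)

lemma Stab.mapFun_toStab (φ : A →⋆ₙₐ[ℂ] B) (x : FinMat A) :
    Stab.mapFun φ (toStab x) = toStab (FinMat.map φ x) :=
  Completion.map_coe (AddMonoidHomClass.lipschitz_of_bound (FinMat.map φ) 1
    (fun x => by simpa using FinMat.norm_map_le φ x)).uniformContinuous x

/-- The *-homomorphism `φ ⊗ id : A ⊗ 𝓚 → B ⊗ 𝓚` induced by `φ : A → B`. -/
def Stab.map (φ : A →⋆ₙₐ[ℂ] B) : Stab A →⋆ₙₐ[ℂ] Stab B where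
  toFun := Stab.mapFun φ
  map_smul' c x := Stab.induction_on x
    (isClosed_eq ((Stab.continuous_mapFun φ).comp (continuous_const_smul c))
      ((continuous_const_smul c).comp (Stab.continuous_mapFun φ)))
    fun x => by
      rw [MonoidHom.id_apply, ← toStab_smul, Stab.mapFun_toStab, Stab.mapFun_toStab, map_smul,
        toStab_smul]
  map_zero' := by rw [← toStab_zero, Stab.mapFun_toStab, map_zero, toStab_zero]
  map_add' x y := Stab.induction_on₂ x y
    (isClosed_eq ((Stab.continuous_mapFun φ).comp continuous_add)
      (((Stab.continuous_mapFun φ).comp continuous_fst).add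
        ((Stab.continuous_mapFun φ).comp continuous_snd)))
    fun x y => by
      rw [← toStab_add, Stab.mapFun_toStab, Stab.mapFun_toStab, Stab.mapFun_toStab, map_add,
        toStab_add]
  map_mul' x y := Stab.induction_on₂ x y
    (isClosed_eq ((Stab.continuous_mapFun φ).comp continuous_mul)
      (((Stab.continuous_mapFun φ).comp continuous_fst).mul
        ((Stab.continuous_mapFun φ).comp continuous_snd)))
    fun x y => by
      rw [← toStab_mul, Stab.mapFun_toStab, Stab.mapFun_toStab, Stab.mapFun_toStab, map_mul,
        toStab_mul]
  map_star' x := Stab.induction_on x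
    (isClosed_eq ((Stab.continuous_mapFun φ).comp Stab.continuous_star)
      (Stab.continuous_star.comp (Stab.continuous_mapFun φ)))
    fun x => by
      rw [← toStab_star, Stab.mapFun_toStab, Stab.mapFun_toStab, map_star, toStab_star]

end Stabilization

/-! ## The Cuntz semigroup -/

section Cuntz

variable {A : Type u} [NonUnitalCStarAlgebra A] {B : Type v} [NonUnitalCStarAlgebra B]

/-- Cuntz comparison: `a` is Cuntz smaller than `b` if `dₙ* b dₙ → a` for some sequence `(dₙ)`. -/
def CuntzLE (a b : A) : Prop :=
  ∃ d : ℕ → A, Tendsto (fun n => star (d n) * b * d n) atTop (𝓝 a)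

lemma cuntzLE_iff {a b : A} : CuntzLE a b ↔ ∀ ε > 0, ∃ d : A, ‖star d * b * d - a‖ < ε := by
  constructor
  · rintro ⟨d, hd⟩ ε hε
    obtain ⟨N, hN⟩ := Metric.tendsto_atTop.1 hd ε hε
    exact ⟨d N, by simpa [dist_eq_norm] using hN N le_rfl⟩
  · intro h
    choose d hd using fun n : ℕ => h (1 / ((n : ℝ) + 1)) (by positivity)
    refine ⟨d, tendsto_iff_norm_sub_tendsto_zero.2 ?_⟩
    exact squeeze_zero (fun _ => norm_nonneg _) (fun n => (hd n).le)
      tendsto_one_div_add_atTop_nhds_zero_nat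

lemma CuntzLE.trans {a b c : A} (hab : CuntzLE a b) (hbc : CuntzLE b c) : CuntzLE a c := by
  rw [cuntzLE_iff] at hab hbc ⊢
  intro ε hε
  obtain ⟨d, hd⟩ := hab (ε / 2) (by positivity)
  obtain ⟨e, he⟩ := hbc (ε / 2 / (‖d‖ * ‖d‖ + 1)) (by positivity)
  refine ⟨e * d, ?_⟩
  have h1 : star (e * d) * c * (e * d) - a =
      star d * (star e * c * e - b) * d + (star d * b * d - a) := by
    rw [star_mul, mul_sub, sub_mul]
    simp only [mul_assoc]
    abel
  have h2 : ‖star d * (star e * c * e - b) * d‖ ≤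
      ε / 2 / (‖d‖ * ‖d‖ + 1) * (‖d‖ * ‖d‖) := by
    calc ‖star d * (star e * c * e - b) * d‖
        ≤ ‖star d‖ * ‖star e * c * e - b‖ * ‖d‖ :=
          (norm_mul_le _ _).trans (by gcongr; exact norm_mul_le _ _)
      _ = ‖star e * c * e - b‖ * (‖d‖ * ‖d‖) := by rw [norm_star]; ring
      _ ≤ _ := by gcongr
  have h3 : ε / 2 / (‖d‖ * ‖d‖ + 1) * (‖d‖ * ‖d‖) ≤ ε / 2 := by
    rw [div_mul_eq_mul_div, div_le_iff₀ (by positivity)]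
    nlinarith [mul_self_nonneg ‖d‖]
  rw [h1]
  linarith [norm_add_le (star d * (star e * c * e - b) * d) (star d * b * d - a)]

lemma CuntzLE.map {a b : A} (φ : A →⋆ₙₐ[ℂ] B) (h : CuntzLE a b) : CuntzLE (φ a) (φ b) := by
  rw [cuntzLE_iff] at h ⊢
  intro ε hε
  obtain ⟨d, hd⟩ := h ε hε
  refine ⟨φ d, ?_⟩
  rw [← map_star, ← map_mul, ← map_mul, ← map_sub]
  exact (NonUnitalStarAlgHom.norm_apply_le φ _).trans_lt hd

lemma CuntzLE.refl (a : A) : CuntzLE a a := by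
  rw [cuntzLE_iff]
  intro ε hε
  let _ := CStarAlgebra.spectralOrder A
  have _ := CStarAlgebra.spectralOrderedRing A
  have hl := CStarAlgebra.increasingApproximateUnit A
  have hleft := Metric.tendsto_nhds.1 (hl.tendsto_mul_left a) (ε / 2) (by positivity)
  have hright := Metric.tendsto_nhds.1 (hl.tendsto_mul_right a) (ε / 2) (by positivity)
  obtain ⟨e, h1, h2, h3, h4⟩ :=
    (hleft.and (hright.and (hl.eventually_norm.and hl.eventually_nonneg))).exists
  rw [dist_eq_norm] at h1 h2
  refine ⟨e, ?_⟩
  rw [h4.isSelfAdjoint.star_eq]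
  have h5 : e * a * e - a = (e * a - a) * e + (a * e - a) := by
    rw [sub_mul]
    abel
  have h6 : ‖(e * a - a) * e‖ ≤ ‖e * a - a‖ :=
    (norm_mul_le _ _).trans (mul_le_of_le_one_right (norm_nonneg _) h3)
  rw [h5]
  linarith [norm_add_le ((e * a - a) * e) (a * e - a)]

/-- The positive elements of `A ⊗ 𝓚`, preordered by Cuntz comparison. -/
def PosStab (A : Type u) [NonUnitalCStarAlgebra A] : Type u := {a : Stab A // 0 ≤ a}

instance : Preorder (PosStab A) where
  le a b := CuntzLE a.1 b.1
  le_refl a := CuntzLE.refl a.1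
  le_trans _ _ _ := CuntzLE.trans

/-- The Cuntz semigroup `Cu(A)` as an ordered set: the Cuntz equivalence classes of the positive
elements of `A ⊗ 𝓚`, ordered by Cuntz comparison of representatives. -/
abbrev Cu (A : Type u) [NonUnitalCStarAlgebra A] : Type u :=
  Antisymmetrization (PosStab A) (· ≤ ·)

/-- The class `[a]` of a positive element `a` of `A ⊗ 𝓚`. -/
def Cu.mk (a : Stab A) (ha : 0 ≤ a) : Cu A := toAntisymmetrization (· ≤ ·) (⟨a, ha⟩ : PosStab A)

/-- The map on positive elements given by `φ ⊗ id`. -/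
def PosStab.map (φ : A →⋆ₙₐ[ℂ] B) : PosStab A →o PosStab B where
  toFun a := ⟨Stab.map φ a.1, map_nonneg (Stab.map φ) a.2⟩
  monotone' _ _ h := CuntzLE.map (Stab.map φ) h

/-- `Cu(φ) : Cu(A) → Cu(B)`, `[a] ↦ [(φ ⊗ id)(a)]`. -/
def Cu.map (φ : A →⋆ₙₐ[ℂ] B) : Cu A →o Cu B := (PosStab.map φ).antisymmetrization

end Cuntz

/-! ## Homomorphisms from `C₀(0,1]` and the pseudometrics -/

section Main

open scoped NNReal

/-- The C*-algebra `C₀(0,1]`. -/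
abbrev C01 : Type := ZeroAtInftyContinuousMap (Set.Ioc (0 : ℝ) 1) ℂ

/-- The restriction to `(0,1]` of a continuous real function that vanishes at `0`. -/
def C01.ofReal (g : ℝ → ℝ) (hg : Continuous g) (h0 : g 0 = 0) : C01 where
  toFun x := (g x : ℂ)
  continuous_toFun := by fun_prop
  zero_at_infty' := by
    rw [Metric.tendsto_nhds]
    intro ε hε
    obtain ⟨δ, hδ, h⟩ := Metric.continuousAt_iff.1 hg.continuousAt ε hε
    rw [h0] at h
    rw [Filter.Eventually, Filter.mem_cocompact]
    refine ⟨Subtype.val ⁻¹' Set.Icc δ 1, ?_, ?_⟩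
    · rw [Subtype.isCompact_iff]
      convert isCompact_Icc (a := δ) (b := 1) using 1
      rw [Subtype.image_preimage_coe]
      exact Set.inter_eq_right.2 fun x hx => ⟨hδ.trans_le hx.1, hx.2⟩
    · intro x hx
      have hx' : (x : ℝ) < δ := by
        by_contra hcon
        exact hx ⟨not_lt.1 hcon, x.2.2⟩
      have := @h x (by rw [Real.dist_eq, sub_zero, abs_of_pos x.2.1]; exact hx')
      simpa [dist_eq_norm] using this

/-- The function `id ∈ C₀(0,1]`, `id(x) = x`. -/
def C01.ident : C01 := C01.ofReal (fun x => x) continuous_id rfl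

/-- The function `e_t ∈ C₀(0,1]`, `e_t(x) = max(x - t, 0)`, for `t ≥ 0`. -/
def C01.e (t : ℝ≥0) : C01 :=
  C01.ofReal (fun x => max (x - t) 0) (by fun_prop) (by simp)

lemma C01.corner_e_nonneg (t : ℝ≥0) : 0 ≤ corner (C01.e t) := by
  have h : C01.e t =
      star (C01.ofReal (fun x => √(max (x - t) 0)) (by fun_prop) (by simp)) *
        C01.ofReal (fun x => √(max (x - t) 0)) (by fun_prop) (by simp) := by
    ext x
    simp [C01.e, C01.ofReal, ← Complex.ofReal_mul]
  rw [h, map_mul, map_star]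
  exact star_mul_self_nonneg _

/-- The class `[e_t] ∈ Cu(C₀(0,1])`. -/
def C01.cuE (t : ℝ≥0) : Cu C01 := Cu.mk (corner (C01.e t)) (C01.corner_e_nonneg t)

variable {A : Type u} [NonUnitalCStarAlgebra A]

/-- The pseudometric `d_W` on the morphisms from `Cu(C₀(0,1])` to `Cu(A)`. -/
def dW (α β : Cu C01 →o Cu A) : ℝ :=
  (sInf {r : ℝ≥0 | ∀ t : ℝ≥0,
    α (C01.cuE (t + r)) ≤ β (C01.cuE t) ∧ β (C01.cuE (t + r)) ≤ α (C01.cuE t)} : ℝ≥0)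

variable (A) in
/-- The unitization `(A ⊗ 𝓚)^~`. -/
abbrev StabUnit : Type u := Unitization ℂ (Stab A)

/-- An element of `A` seen in `(A ⊗ 𝓚)^~`, via the top left corner of `A ⊗ 𝓚`. -/
def inStabUnit (a : A) : StabUnit A := Unitization.inr (corner a)

/-- Stable approximate unitary equivalence of elements: `uₙ* a uₙ → b` for some unitaries
`uₙ ∈ (A ⊗ 𝓚)^~`. -/
def StablyApproxUnitEquiv (a b : A) : Prop :=
  ∃ u : ℕ → unitary (StabUnit A),
    Tendsto (fun n => star (u n : StabUnit A) * inStabUnit a * (u n : StabUnit A)) atTop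
      (𝓝 (inStabUnit b))

/-- Stable approximate unitary equivalence of homomorphisms from `C₀(0,1]`: `uₙ φ uₙ* → ψ`
pointwise for some unitaries `uₙ ∈ (A ⊗ 𝓚)^~`. -/
def StablyApproxUnitEquivHom (φ ψ : C01 →⋆ₙₐ[ℂ] A) : Prop :=
  ∃ u : ℕ → unitary (StabUnit A), ∀ f : C01,
    Tendsto (fun n => (u n : StabUnit A) * inStabUnit (φ f) * star (u n : StabUnit A)) atTop
      (𝓝 (inStabUnit (ψ f)))

/-- `d_U(a,b)`: the distance between the orbits of `a` and `b` under the unitaries of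
`(A ⊗ 𝓚)^~`. -/
def dU (a b : A) : ℝ :=
  ⨅ p : unitary (StabUnit A) × unitary (StabUnit A),
    ‖(p.1 : StabUnit A) * inStabUnit a * star (p.1 : StabUnit A) -
      (p.2 : StabUnit A) * inStabUnit b * star (p.2 : StabUnit A)‖

/-- Property (I). -/
def PropertyI (A : Type u) [NonUnitalCStarAlgebra A] [PartialOrder A] [StarOrderedRing A] : Prop :=
  ∀ x e : A, 0 ≤ e → ‖e‖ ≤ 1 → e * x = x → x * e = x →
    StablyApproxUnitEquiv (star x * x + e) (x * star x + e)

/-- Property (II). -/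
def PropertyII (A : Type u) [NonUnitalCStarAlgebra A] : Prop :=
  ∀ φ ψ : C01 →⋆ₙₐ[ℂ] A, dW (Cu.map φ) (Cu.map ψ) = 0 → StablyApproxUnitEquivHom φ ψ

end Main

end StableCu
end

noncomputable section

open Filter Topology
open scoped NNReal

namespace StableCu

-- For a positive contraction `a = φ(id)`, the classes `[φ(e_t)]` record the Cuntz classes of the
-- cut-downs `(a - t)₊`. The argument compares such cut-downs, first up to Cuntz comparison and then
-- up to unitaries.
--
-- The basic tool is a polar decomposition by approximation (`exists_tendsto_star_mul_self_eq`): if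
-- `s² ≤ y* y` with `s` self-adjoint, then `y (y* y + ε)^(-1/2) s` converges to some `d` with `d* d
-- = s²`. Combined with functional calculus it turns an approximate relation `φ(e_t) ≈ y* y` into an
-- exact factorization of `φ(F)` for every `F ≥ 0` supported slightly further to the right. This
-- gives `d_W ≤ d_U` (`dW_le_dU`), and it also turns Cuntz comparisons into elements `z` of `A` with
-- prescribed `z* z`.
--
-- For the upper bound, suppose that `r` is admissible in `d_W`. Nearly characteristic functions of
-- the half-lines to the right of `kρ`, with `ρ` slightly larger than `r`, are evaluated in `φ` for
-- even `k` and in `ψ` for odd `k`. Composing the factorizations of consecutive levels gives `v_k`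
-- (`exists_interlacing_sequence`) with `v_k* v_k` equal to the `k`-th level and `v_k v_k*`
-- decreasing. Up to about `ρ`, `φ(id)` is a weighted sum of the `v_k* v_k` over even `k`, and
-- `ψ(id)` is one over odd `k`. Property (I) allows `v_k* v_k` to be replaced by `v_k v_k*`
-- simultaneously in each sum (`PropertyI.stablyApproxUnitEquiv_sum`). The two resulting sums differ
-- by an alternating sum of a decreasing sequence, of norm at most `ρ` (`norm_alternating_sum_le`).
-- The three errors add up to about `3ρ`, so in fact `d_U ≤ 3 d_W`.
--
-- Hence (I) gives (II): `d_W = 0` forces `d_U = 0`, and convergence at `id` implies convergence at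
-- every function. Conversely, given `x` and `e` as in (I), rescale to positive contractions and
-- compare the homomorphisms defined by multiples of `x* x + e` and `x x* + e`. All their cut-downs
-- are Cuntz equivalent (`cuntzLE_cutOff_add`), so `d_W = 0` and (II) applies.

universe u v

/-! ### Polar decomposition by approximation -/

section Douglas

lemma cfc_mul_self_mul_cfc {B : Type u} [CStarAlgebra B] {c : B} (hc : IsSelfAdjoint c) {f : ℝ → ℝ}
    (hf : ContinuousOn f (spectrum ℝ c)) :
    cfc f c * c * cfc f c = cfc (fun t => f t * t * f t) c := by
  conv_lhs => enter [1, 2]; rw [← cfc_id' ℝ c]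
  rw [← cfc_mul f (fun t => t) c hf, ← cfc_mul (fun t => f t * t) f c (hf.mul (by fun_prop)) hf]

variable {B : Type u} [CStarAlgebra B] [PartialOrder B] [StarOrderedRing B]

/-- By the C*-identity, `‖m(c) s‖² = ‖m(c) s² m(c)‖ ≤ ‖m(c) c m(c)‖`, and the last norm is
controlled by the values `t m(t)²`. All the estimates for the decomposition below reduce to such
scalar bounds. -/
lemma norm_cfc_mul_le_of_sq_le {s c : B} (hs : IsSelfAdjoint s) (hsc : s * s ≤ c) {m : ℝ → ℝ}
    (hm : ContinuousOn m (Set.Ici 0)) {C : ℝ} (hC0 : 0 ≤ C)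
    (hC : ∀ t, 0 ≤ t → √t * |m t| ≤ C) : ‖cfc m c * s‖ ≤ C := by
  have hc : 0 ≤ c := (hs.mul_self_nonneg).trans hsc
  have hspec : ∀ t ∈ spectrum ℝ c, 0 ≤ t := fun t ht => spectrum_nonneg_of_nonneg hc ht
  have hm' : ContinuousOn m (spectrum ℝ c) := hm.mono hspec
  have hM : IsSelfAdjoint (cfc m c) := cfc_predicate m c
  refine abs_le_of_sq_le_sq' ?_ hC0 |>.2
  have e1 : ‖cfc m c * s‖ ^ 2 = ‖cfc m c * (s * s) * cfc m c‖ := by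
    rw [sq, ← CStarRing.norm_self_mul_star, star_mul, hs.star_eq, hM.star_eq]
    simp only [mul_assoc]
  have e2 : cfc m c * (s * s) * cfc m c ≤ cfc m c * c * cfc m c := by
    have := star_right_conjugate_le_conjugate hsc (cfc m c)
    rwa [hM.star_eq] at this
  have e3 : cfc m c * c * cfc m c = cfc (fun t => m t * t * m t) c :=
    cfc_mul_self_mul_cfc hc.isSelfAdjoint hm'
  have e0 : 0 ≤ cfc m c * (s * s) * cfc m c := by
    have := star_right_conjugate_nonneg (hs.mul_self_nonneg) (cfc m c)
    rwa [hM.star_eq] at this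
  rw [e1]
  refine (CStarAlgebra.norm_le_norm_of_nonneg_of_le e0 e2).trans ?_
  rw [e3]
  refine norm_cfc_le (by positivity) fun t ht => ?_
  have ht0 := hspec t ht
  have h1 : m t * t * m t = (√t * |m t|) ^ 2 := by
    rw [mul_pow, Real.sq_sqrt ht0, sq_abs]; ring
  rw [h1, Real.norm_of_nonneg (by positivity)]
  exact pow_le_pow_left₀ (by positivity) (hC t ht0) 2

lemma abs_div_sqrt_add_sub_sqrt_le {t ε : ℝ} (ht : 0 ≤ t) (hε : 0 < ε) :
    |t / √(t + ε) - √t| ≤ √ε := by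
  have h1 : 0 < √(t + ε) := Real.sqrt_pos.2 (by linarith)
  have h2 : √t ≤ √(t + ε) := Real.sqrt_le_sqrt (by linarith)
  have h3 : √(t + ε) ≤ √t + √ε := by
    rw [Real.sqrt_le_left (by positivity)]
    nlinarith [Real.sq_sqrt ht, Real.sq_sqrt hε.le, mul_nonneg (Real.sqrt_nonneg t) (Real.sqrt_nonneg ε)]
  have h4 : t / √(t + ε) - √t = - (√t * (√(t + ε) - √t) / √(t + ε)) := by
    field_simp
    nlinarith [Real.sq_sqrt ht]
  rw [h4, abs_neg, abs_of_nonneg (div_nonneg (mul_nonneg (Real.sqrt_nonneg _) (by linarith)) h1.le),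
    div_le_iff₀ h1]
  have := Real.sqrt_nonneg t
  nlinarith [Real.sqrt_nonneg ε]

/-- With `c = y* y`, the elements `y (c + ε)^(-1/2) s` are Cauchy as `ε → 0`. The limit is stated
together with its approximants `y k_n s`, so that membership in a closed ideal or invariance under
left multiplication can be read off from `y` and `s`. -/
theorem exists_tendsto_star_mul_self_eq {y s : B} (hs : IsSelfAdjoint s)
    (hle : s * s ≤ star y * y) :
    ∃ (k : ℕ → B) (d : B), Tendsto (fun n => y * k n * s) atTop (𝓝 d) ∧ star d * d = s * s := by
  set c := star y * y with hc
  have hc0 : 0 ≤ c := star_mul_self_nonneg y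
  have hspec : ∀ t ∈ spectrum ℝ c, 0 ≤ t := fun t ht => spectrum_nonneg_of_nonneg hc0 ht
  let ε : ℕ → ℝ := fun n => 1 / ((n : ℝ) + 1)
  have hε : ∀ n, 0 < ε n := fun n => by positivity
  have hεlim : Tendsto ε atTop (𝓝 0) := tendsto_one_div_add_atTop_nhds_zero_nat
  let k : ℕ → ℝ → ℝ := fun n t => 1 / √(t + ε n)
  have hk : ∀ n, ContinuousOn (k n) (Set.Ici 0) := fun n => by
    refine ContinuousOn.div (by fun_prop) (by fun_prop) fun t ht => ?_
    have := hε n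
    exact (Real.sqrt_pos.2 (by linarith [show (0:ℝ) ≤ t from ht])).ne'
  have hk' : ∀ n, ContinuousOn (k n) (spectrum ℝ c) := fun n => (hk n).mono hspec
  have hsq : ContinuousOn (fun t : ℝ => √t) (Set.Ici 0) := by fun_prop
  -- Under the norm, `y` may be replaced by `√c`, since `y* y = c`.
  have norm_y : ∀ (f : ℝ → ℝ), ContinuousOn f (Set.Ici 0) →
      ‖y * cfc f c * s‖ = ‖cfc (fun t => √t * f t) c * s‖ := by
    intro f hf
    have hf' := hf.mono hspec
    have hsq' := hsq.mono hspec
    have h1 : star (y * cfc f c * s) * (y * cfc f c * s) =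
        star (cfc (fun t => √t * f t) c * s) * (cfc (fun t => √t * f t) c * s) := by
      have h2 : cfc f c * c * cfc f c = cfc (fun t => √t * f t) c * cfc (fun t => √t * f t) c := by
        rw [cfc_mul_self_mul_cfc hc0.isSelfAdjoint hf',
          ← cfc_mul (fun t => √t * f t) (fun t => √t * f t) c (hsq'.mul hf') (hsq'.mul hf')]
        refine cfc_congr fun t ht => ?_
        have := Real.mul_self_sqrt (hspec t ht)
        linear_combination (-(f t * f t)) * this
      simp only [star_mul, hs.star_eq, (cfc_predicate f c : IsSelfAdjoint _).star_eq,
        (cfc_predicate (fun t => √t * f t) c : IsSelfAdjoint _).star_eq]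
      calc _ = s * (cfc f c * c * cfc f c) * s := by simp only [hc, mul_assoc]
        _ = _ := by rw [h2]; simp only [mul_assoc]
    have h3 := congrArg norm h1
    rw [CStarRing.norm_star_mul_self, CStarRing.norm_star_mul_self] at h3
    exact (mul_self_inj (norm_nonneg _) (norm_nonneg _)).1 h3
  have hcauchy : CauchySeq fun n => y * cfc (k n) c * s := by
    refine cauchySeq_of_le_tendsto_0' (fun n => 2 * √(ε n)) (fun n m hnm => ?_) ?_
    · rw [dist_eq_norm, ← sub_mul, ← mul_sub, ← cfc_sub _ _ c (hk' n) (hk' m),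
        norm_y (fun t => k n t - k m t) ((hk n).sub (hk m))]
      have hmn : ε m ≤ ε n := one_div_le_one_div_of_le (by positivity) (by gcongr)
      refine norm_cfc_mul_le_of_sq_le hs hle (hsq.mul ((hk n).sub (hk m))) (by positivity) ?_
      intro t ht
      change √t * |√t * (k n t - k m t)| ≤ _
      rw [abs_mul, abs_of_nonneg (Real.sqrt_nonneg t), ← mul_assoc, Real.mul_self_sqrt ht]
      have h1 : t * |k n t - k m t| = |(t / √(t + ε n) - √t) - (t / √(t + ε m) - √t)| := by
        rw [← abs_of_nonneg ht, ← abs_mul, abs_of_nonneg ht]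
        congr 1
        simp only [k]
        ring
      rw [h1]
      have := abs_div_sqrt_add_sub_sqrt_le ht (hε n)
      have := abs_div_sqrt_add_sub_sqrt_le ht (hε m)
      have := Real.sqrt_le_sqrt hmn
      linarith [abs_sub (t / √(t + ε n) - √t) (t / √(t + ε m) - √t)]
    · have := (hεlim.sqrt).const_mul 2
      simpa using this
  obtain ⟨d, hd⟩ := cauchySeq_tendsto_of_complete hcauchy
  refine ⟨fun n => cfc (k n) c, d, hd, ?_⟩
  have hlim : Tendsto (fun n => star (y * cfc (k n) c * s) * (y * cfc (k n) c * s)) atTop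
      (𝓝 (star d * d)) := hd.star.mul hd
  refine tendsto_nhds_unique hlim ?_
  rw [tendsto_iff_norm_sub_tendsto_zero]
  refine squeeze_zero (fun _ => norm_nonneg _) (g := ε) (fun n => ?_) hεlim
  let M : ℝ → ℝ := fun t => √(ε n / (t + ε n))
  have hpos : ∀ t : ℝ, 0 ≤ t → 0 < t + ε n := fun t ht => by have := hε n; linarith
  have hM : ContinuousOn M (Set.Ici 0) :=
    (ContinuousOn.div (by fun_prop) (by fun_prop) fun t ht => (hpos t ht).ne').sqrt
  have hM' := hM.mono hspec
  have hMsa : IsSelfAdjoint (cfc M c) := cfc_predicate M c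
  -- `1 - c/(c + ε) = ε/(c + ε) = M(c)²`, so the defect of `d_n* d_n` from `s²` is `-(M(c) s)* (M(c)
  -- s)`, of norm at most `ε`.
  have e1 : cfc M c * cfc M c = 1 - cfc (k n) c * c * cfc (k n) c := by
    rw [cfc_mul_self_mul_cfc hc0.isSelfAdjoint (hk' n), ← cfc_mul M M c hM' hM', ← cfc_one ℝ c,
      ← cfc_sub _ (fun t => k n t * t * k n t) c (by fun_prop)
        (((hk' n).mul (by fun_prop)).mul (hk' n))]
    refine cfc_congr fun t ht => ?_
    have h0 := hpos t (hspec t ht)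
    have h1 : √(t + ε n) ≠ 0 := (Real.sqrt_pos.2 h0).ne'
    have h2 := Real.mul_self_sqrt h0.le
    simp only [M, k, Pi.one_apply]
    rw [Real.mul_self_sqrt (div_nonneg (hε n).le h0.le)]
    field_simp
    rw [Real.sq_sqrt h0.le]
    ring
  have e2 : star (y * cfc (k n) c * s) * (y * cfc (k n) c * s) - s * s =
      - (star (cfc M c * s) * (cfc M c * s)) := by
    have : star (cfc M c * s) * (cfc M c * s) = s * (cfc M c * cfc M c) * s := by
      rw [star_mul, hs.star_eq, hMsa.star_eq]; simp only [mul_assoc]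
    rw [this, e1]
    simp only [star_mul, hs.star_eq, (cfc_predicate (k n) c : IsSelfAdjoint _).star_eq]
    simp only [hc]
    noncomm_ring
  rw [e2, norm_neg, CStarRing.norm_star_mul_self]
  have h4 : ‖cfc M c * s‖ ≤ √(ε n) := by
    refine norm_cfc_mul_le_of_sq_le hs hle hM (Real.sqrt_nonneg _) fun t ht => ?_
    rw [abs_of_nonneg (Real.sqrt_nonneg _), ← Real.sqrt_mul ht]
    refine Real.sqrt_le_sqrt ?_
    have := hpos t ht
    rw [← mul_div_assoc, div_le_iff₀ this]
    nlinarith [hε n]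
  calc _ ≤ √(ε n) * √(ε n) := by gcongr
    _ = ε n := Real.mul_self_sqrt (hε n).le

end Douglas

/-! ### Real functions in `C₀(0,1]` and cut-downs -/

section OfReal

lemma C01.ofReal_apply (g : ℝ → ℝ) (hg : Continuous g) (h0 : g 0 = 0) (x : Set.Ioc (0 : ℝ) 1) :
    C01.ofReal g hg h0 x = (g x : ℂ) := rfl

lemma C01.isSelfAdjoint_ofReal (g : ℝ → ℝ) (hg : Continuous g) (h0 : g 0 = 0) :
    IsSelfAdjoint (C01.ofReal g hg h0) := by
  ext x
  simp [C01.ofReal_apply]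

lemma C01.ofReal_mul_ofReal {f g h : ℝ → ℝ} (hf : Continuous f) (hg : Continuous g)
    (hh : Continuous h) (f0 : f 0 = 0) (g0 : g 0 = 0) (h0 : h 0 = 0)
    (H : ∀ x, 0 < x → x ≤ 1 → f x * g x = h x) :
    C01.ofReal f hf f0 * C01.ofReal g hg g0 = C01.ofReal h hh h0 := by
  ext x
  simp [C01.ofReal_apply, ← H x x.2.1 x.2.2]

lemma C01.norm_ofReal_le {f : ℝ → ℝ} (hf : Continuous f) (f0 : f 0 = 0) {C : ℝ} (hC : 0 ≤ C)
    (H : ∀ x, 0 < x → x ≤ 1 → |f x| ≤ C) : ‖C01.ofReal f hf f0‖ ≤ C := by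
  rw [← ZeroAtInftyContinuousMap.norm_toBCF_eq_norm]
  refine (BoundedContinuousFunction.norm_le hC).2 fun x => ?_
  simpa [C01.ofReal_apply] using H x x.2.1 x.2.2

lemma C01.ident_eq_e : C01.ident = C01.e 0 := by
  ext x
  simp [C01.ident, C01.e, C01.ofReal_apply, max_eq_left x.2.1.le]

end OfReal

section CutDown

variable {B : Type u} [CStarAlgebra B] [PartialOrder B] [StarOrderedRing B]

/-- The hypothesis gives `Φ(e_t) - δ ≤ y* y`. Conjugating by `Φ(E)`, where `E² (x - t - δ) = F` on
the support of `F`, gives `Φ(F) ≤ (y Φ(E))* (y Φ(E))`, to which the polar decomposition applies. The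
margin `η` keeps the denominator of `E` away from zero. -/
theorem exists_tendsto_of_norm_e_sub_le (Φ : C01 →⋆ₙₐ[ℂ] B) {y : B} {t : ℝ≥0} {δ η : ℝ}
    (hδ : 0 ≤ δ) (hη : 0 < η)
    (hy : ‖Φ (C01.e t) - star y * y‖ ≤ δ) {F : ℝ → ℝ} (hF : Continuous F)
    (hFnn : ∀ x, 0 ≤ F x) (hF0 : ∀ x ≤ t + δ + η, F x = 0) (F0 : F 0 = 0) :
    ∃ (k : ℕ → B) (d : B),
      Tendsto (fun n => y * k n * Φ (C01.ofReal (fun x => √(F x)) (by fun_prop) (by simp [F0])))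
        atTop (𝓝 d) ∧ star d * d = Φ (C01.ofReal F hF F0) := by
  have hmax : ∀ x : ℝ, 0 < max (x - t - δ) η := fun x => lt_max_of_lt_right hη
  let E : ℝ → ℝ := fun x => √(F x) / √(max (x - t - δ) η)
  have hE : Continuous E :=
    Continuous.div (by fun_prop) (by fun_prop) fun x => (Real.sqrt_pos.2 (hmax x)).ne'
  have E0 : E 0 = 0 := by simp [E, F0]
  set e := C01.ofReal E hE E0
  set r := C01.ofReal (fun x => √(F x)) (by fun_prop) (by simp [F0])
  have hrr : r * r = C01.ofReal F hF F0 :=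
    C01.ofReal_mul_ofReal _ _ _ _ _ _ fun x _ _ => Real.mul_self_sqrt (hFnn x)
  have he : star e = e := C01.isSelfAdjoint_ofReal ..
  have hkey : e * C01.e t * e - (δ : ℂ) • (e * e) = r * r := by
    ext x
    have : E x * max ((x : ℝ) - t) 0 * E x - δ * (E x * E x) = √(F x) * √(F x) := by
      by_cases hx : (x : ℝ) ≤ t + δ + η
      · simp [E, hF0 x hx]
      · push Not at hx
        have h1 : max ((x : ℝ) - t - δ) η = x - t - δ := max_eq_left (by linarith)
        have h2 : max ((x : ℝ) - t) 0 = x - t := max_eq_left (by linarith)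
        have h3 := Real.mul_self_sqrt (hmax x).le
        have h4 := (Real.sqrt_pos.2 (hmax x)).ne'
        rw [h1] at h3 h4
        simp only [E]
        rw [h1, h2]
        field_simp
        linear_combination (-(√(F x))^2) * h3
    have := congrArg (Complex.ofReal) this
    push_cast at this
    simpa [e, r, C01.e, C01.ofReal_apply] using this
  have hsa : IsSelfAdjoint (Φ (C01.e t) - star y * y) :=
    ((C01.isSelfAdjoint_ofReal _ _ _).map Φ).sub (IsSelfAdjoint.star_mul_self y)
  have hle : Φ (C01.e t) - star y * y ≤ algebraMap ℝ B δ :=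
    hsa.le_algebraMap_norm_self.trans (algebraMap_mono B hy)
  have hle' : Φ (C01.e t) - algebraMap ℝ B δ ≤ star y * y := by
    rw [sub_le_iff_le_add] at hle ⊢
    rwa [add_comm]
  have hconj := star_left_conjugate_le_conjugate hle' (Φ e)
  have hlhs : star (Φ e) * (Φ (C01.e t) - algebraMap ℝ B δ) * Φ e = Φ r * Φ r := by
    rw [← map_mul Φ r r, ← hkey, ← map_star, he, map_sub, map_smul, map_mul, map_mul, map_mul,
      Algebra.algebraMap_eq_smul_one, mul_sub, sub_mul]
    simp only [mul_smul_comm, smul_mul_assoc, mul_one, Complex.coe_smul]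
  have hrhs : star (Φ e) * (star y * y) * Φ e = star (y * Φ e) * (y * Φ e) := by
    rw [star_mul]; simp only [mul_assoc]
  rw [hlhs, hrhs] at hconj
  obtain ⟨k, d, hk, hd⟩ := exists_tendsto_star_mul_self_eq
    ((C01.isSelfAdjoint_ofReal _ _ _).map Φ) hconj
  refine ⟨fun n => Φ e * k n, d, ?_, ?_⟩
  · simpa only [mul_assoc] using hk
  · rw [hd, ← map_mul, hrr]

end CutDown

/-! ### The top left corner is hereditary -/

section FinMatInjective

attribute [local instance] CStarAlgebra.spectralOrder
attribute [local instance] CStarAlgebra.spectralOrderedRing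

lemma FinMat.of_injective {A : Type u} [NonUnitalCStarAlgebra A] (n : ℕ) : Function.Injective (FinMat.of A n) := by
  refine (injective_iff_map_eq_zero _).2 fun M hM => ?_
  have h : ‖FinMat.of A n M‖ = 0 := by rw [hM, norm_zero]
  rwa [FinMat.norm_of, norm_eq_zero] at h

end FinMatInjective

section Corner

variable {A : Type u} [NonUnitalCStarAlgebra A] {B : Type v} [NonUnitalCStarAlgebra B]

lemma toStab_injective : Function.Injective (toStab (A := A)) :=
  UniformSpace.Completion.coe_injective (FinMat A)

lemma oneByOne_apply (a : A) (i j : Fin 1) : oneByOne a i j = a := rfl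

lemma corner_injective : Function.Injective (corner (A := A)) := by
  intro a b hab
  have h := FinMat.of_injective 1 (toStab_injective hab)
  exact congrArg (fun M : Mat A 1 => M 0 0) h

lemma norm_corner (a : A) : ‖corner a‖ = ‖a‖ :=
  NonUnitalStarAlgHom.norm_map corner corner_injective a

lemma isClosed_range_corner : IsClosed (Set.range (corner (A := A))) :=
  (AddMonoidHomClass.isometry_of_norm (corner (A := A)) norm_corner).isClosedEmbedding.isClosed_range

lemma corner_eq (m : ℕ) (a : A) :
    corner a = toStab (FinMat.of A (m + 1) (pad 1 (m + 1) (by omega) (oneByOne a))) := by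
  rw [FinMat.of_pad]
  rfl

lemma corner_mul_mul_corner_mem (a b : A) (x : Stab A) :
    corner a * x * corner b ∈ Set.range (corner (A := A)) := by
  refine Stab.induction_on x ?_ fun x => ?_
  · exact isClosed_range_corner.preimage (by fun_prop)
  · obtain ⟨n, M, rfl⟩ := x.exists_of
    -- Enlarging the matrix by one row and column ensures that the entry `(0, 0)` exists even when
    -- `n = 0`.
    rw [← FinMat.of_pad (Nat.le_succ n) M]
    set N := pad n n.succ (Nat.le_succ n) M
    refine ⟨a * N 0 0 * b, ?_⟩
    rw [corner_eq n a, corner_eq n b, corner_eq n, ← toStab_mul, ← toStab_mul, ← map_mul, ← map_mul]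
    congr 2
    ext i j
    simp only [CStarMatrix.mul_apply, pad_apply, Fin.sum_univ_succ]
    by_cases hi : i = 0 <;> by_cases hj : j = 0 <;>
      simp [hi, hj, oneByOne_apply]

/-- Approximate units `p`, `q` from `A` cut the comparing element `d` of `A ⊗ 𝓚` down to `q d p`,
which lies in the corner. The element `q` is chosen last, since its tolerance depends on `d` and
`p`. -/
lemma CuntzLE.of_corner {a b : A} (h : CuntzLE (corner a) (corner b)) : CuntzLE a b := by
  have key : ∀ c : A, ∀ ε > 0, ∃ d : A, ‖star (corner d) * corner c * corner d - corner c‖ < ε := by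
    intro c ε hε
    obtain ⟨d, hd⟩ := cuntzLE_iff.1 (CuntzLE.refl c) ε hε
    refine ⟨d, ?_⟩
    rwa [← map_star, ← map_mul, ← map_mul, ← map_sub, norm_corner]
  have bound : ∀ x y : Stab A, ∀ ε > 0, ‖y‖ < ε / (‖x‖ * ‖x‖ + 1) → ‖star x * y * x‖ < ε := by
    intro x y ε hε hy
    rw [lt_div_iff₀ (by positivity)] at hy
    calc ‖star x * y * x‖ ≤ ‖star x‖ * ‖y‖ * ‖x‖ :=
          (norm_mul_le _ _).trans (by gcongr; exact norm_mul_le _ _)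
      _ = ‖y‖ * (‖x‖ * ‖x‖) := by rw [norm_star]; ring
      _ ≤ ‖y‖ * (‖x‖ * ‖x‖ + 1) := by gcongr; linarith
      _ < ε := hy
  rw [cuntzLE_iff]
  intro ε hε
  obtain ⟨p, hp⟩ := key a (ε / 3) (by positivity)
  obtain ⟨d, hd⟩ := cuntzLE_iff.1 h (ε / 3 / (‖corner p‖ * ‖corner p‖ + 1)) (by positivity)
  obtain ⟨q, hq⟩ := key b (ε / 3 / (‖d * corner p‖ * ‖d * corner p‖ + 1)) (by positivity)
  obtain ⟨w, hw⟩ := corner_mul_mul_corner_mem q p d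
  refine ⟨w, ?_⟩
  have h1 := bound _ _ _ (by positivity) hd
  have h2 := bound _ _ _ (by positivity) hq
  rw [← norm_corner, map_sub, map_mul, map_mul, map_star, hw]
  have : star (corner q * d * corner p) * corner b * (corner q * d * corner p) - corner a =
      star (d * corner p) * (star (corner q) * corner b * corner q - corner b) * (d * corner p) +
      star (corner p) * (star d * corner b * d - corner a) * corner p +
      (star (corner p) * corner a * corner p - corner a) := by
    simp only [star_mul]
    noncomm_ring
  rw [this]
  refine (norm_add₃_le).trans_lt ?_
  linarith

lemma cuntzLE_corner_iff {a b : A} : CuntzLE (corner a) (corner b) ↔ CuntzLE a b :=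
  ⟨CuntzLE.of_corner, CuntzLE.map corner⟩

lemma Stab.map_corner (φ : A →⋆ₙₐ[ℂ] B) (a : A) : Stab.map φ (corner a) = corner (φ a) := by
  change Stab.mapFun φ (toStab (FinMat.of A 1 (oneByOne a))) = _
  rw [Stab.mapFun_toStab, FinMat.map_of]
  rfl

lemma Cu.map_cuE_le_iff (φ ψ : C01 →⋆ₙₐ[ℂ] A) (s t : ℝ≥0) :
    Cu.map φ (C01.cuE s) ≤ Cu.map ψ (C01.cuE t) ↔ CuntzLE (φ (C01.e s)) (ψ (C01.e t)) := by
  change CuntzLE (Stab.map φ (corner (C01.e s))) (Stab.map ψ (corner (C01.e t))) ↔ _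
  rw [Stab.map_corner, Stab.map_corner, cuntzLE_corner_iff]

end Corner

/-! ### The inequality `d_W ≤ d_U` -/

section Distance

variable {A : Type u} [NonUnitalCStarAlgebra A]

/-- The embedding of `A` in `(A ⊗ 𝓚)^~` as a *-homomorphism. -/
def inStabUnitHom : A →⋆ₙₐ[ℂ] StabUnit A :=
  (Unitization.inrNonUnitalStarAlgHom ℂ (Stab A)).comp corner

lemma inStabUnitHom_apply (a : A) : inStabUnitHom a = inStabUnit a := rfl

lemma norm_inStabUnit (a : A) : ‖inStabUnit a‖ = ‖a‖ := by
  rw [inStabUnit, Unitization.norm_inr, norm_corner]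

lemma C01.norm_e_sub_ident_le (t : ℝ≥0) : ‖C01.e t - C01.ident‖ ≤ t := by
  have : C01.e t - C01.ident = C01.ofReal (fun x => max (x - t) 0 - x) (by fun_prop) (by simp) := by
    ext x
    simp [C01.e, C01.ident, C01.ofReal_apply]
  rw [this]
  refine C01.norm_ofReal_le _ _ t.2 fun x hx _ => ?_
  have := t.2
  rw [abs_le]
  change 0 ≤ (t : ℝ) at this
  change -(t : ℝ) ≤ _ ∧ _ ≤ (t : ℝ)
  constructor
  · linarith [le_max_left (x - t) 0]
  · linarith [max_le (show x - (t : ℝ) ≤ x + t by linarith) (show (0 : ℝ) ≤ x + t by linarith)]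

lemma exists_inr_mul_inr {E : Type u} [NonUnitalCStarAlgebra E] (x : Unitization ℂ E) (b : E) :
    ∃ c : E, x * (b : Unitization ℂ E) = c := by
  refine ⟨x.fst • b + x.snd * b, ?_⟩
  ext <;> simp

/-- Let `N < r` be the norm in `h`. Since `e_t` is within `t` of `id`, the conjugate of `ψ(e_t)` by
`u` is within `N + t` of `φ(id)`, so that the cut-down of `φ(id)` at `t + r` factors through
`ψ(e_t)`. -/
lemma cuntzLE_e_of_norm_lt (φ ψ : C01 →⋆ₙₐ[ℂ] A) (u : unitary (StabUnit A)) {r t : ℝ≥0}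
    (h : ‖(u : StabUnit A) * inStabUnit (ψ C01.ident) * star (u : StabUnit A) -
      inStabUnit (φ C01.ident)‖ < r) :
    CuntzLE (φ (C01.e (t + r))) (ψ (C01.e t)) := by
  rw [← cuntzLE_corner_iff]
  set N := ‖(u : StabUnit A) * inStabUnit (ψ C01.ident) * star (u : StabUnit A) -
      inStabUnit (φ C01.ident)‖ with hN
  let q : C01 := C01.ofReal (fun x => √(max (x - t) 0)) (by fun_prop) (by simp)
  have hqq : star q * q = C01.e t := by
    rw [(C01.isSelfAdjoint_ofReal _ _ _).star_eq]
    exact C01.ofReal_mul_ofReal _ _ _ _ _ _ fun x _ _ => Real.mul_self_sqrt (le_max_right _ _)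
  let Φ := (inStabUnitHom (A := A)).comp φ
  let Ψ := (inStabUnitHom (A := A)).comp ψ
  let y : StabUnit A := Ψ q * star (u : StabUnit A)
  have hyy : star y * y = (u : StabUnit A) * Ψ (C01.e t) * star (u : StabUnit A) := by
    simp only [y, star_mul, star_star, ← hqq, map_mul, map_star, mul_assoc]
  have hconj : ∀ x : StabUnit A, ‖(u : StabUnit A) * x * star (u : StabUnit A)‖ = ‖x‖ := by
    intro x
    rw [← Unitary.coe_star, CStarRing.norm_mul_coe_unitary, CStarRing.norm_coe_unitary_mul]
  have hnorm : ‖Φ (C01.e 0) - star y * y‖ ≤ N + t := by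
    rw [← C01.ident_eq_e, hyy, norm_sub_rev]
    have : (u : StabUnit A) * Ψ (C01.e t) * star (u : StabUnit A) - Φ C01.ident =
        ((u : StabUnit A) * Ψ C01.ident * star (u : StabUnit A) - Φ C01.ident) +
        (u : StabUnit A) * Ψ (C01.e t - C01.ident) * star (u : StabUnit A) := by
      rw [map_sub]; noncomm_ring
    rw [this]
    refine (norm_add_le _ _).trans (add_le_add le_rfl ?_)
    rw [hconj]
    exact (NonUnitalStarAlgHom.norm_apply_le Ψ _).trans (C01.norm_e_sub_ident_le t)
  -- The cut-off is taken from level `0`: with `δ = N + t` and `η = r - N`, the threshold `δ + η` is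
  -- exactly `t + r`.
  obtain ⟨k, d, hk, hd⟩ := exists_tendsto_of_norm_e_sub_le Φ (y := y) (t := 0) (δ := N + t)
    (η := r - N) (add_nonneg (norm_nonneg _) t.2) (sub_pos.2 h) hnorm
    (F := fun x => max (x - ((t + r : ℝ≥0) : ℝ)) 0) (by fun_prop) (fun x => le_max_right _ _)
    (fun x hx => max_eq_right (by push_cast at hx ⊢; linarith)) (max_eq_right (by rw [zero_sub]; exact neg_nonpos.2 (t + r).2))
  set s := C01.ofReal (fun x => √(max (x - ((t + r : ℝ≥0) : ℝ)) 0)) (by fun_prop)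
    (by simp only [zero_sub]; rw [max_eq_right (neg_nonpos.2 (NNReal.coe_nonneg (t + r))), Real.sqrt_zero])
  -- The approximants lie in the ideal `A ⊗ 𝓚` because they end in the factor `φ(s)`. Hence they
  -- witness comparison in `A ⊗ 𝓚` and not only in its unitization.
  choose c hc using fun n => exists_inr_mul_inr (star (u : StabUnit A) * k n) (corner (φ s))
  refine ⟨c, ?_⟩
  have hiso := (Unitization.isometry_inr (𝕜 := ℂ) (A := Stab A)).isEmbedding
  rw [hiso.tendsto_nhds_iff]
  have hlim := hk.star.mul hk
  rw [hd] at hlim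
  refine hlim.congr fun n => ?_
  change _ = ((star (c n) * corner (ψ (C01.e t)) * c n : Stab A) : StabUnit A)
  rw [Unitization.inr_mul, Unitization.inr_mul, Unitization.inr_star, ← hc n]
  change _ = star (star (u : StabUnit A) * k n * Φ s) * Ψ (C01.e t) * (star (u : StabUnit A) * k n * Φ s)
  rw [← hqq, map_mul, map_star]
  simp only [y, star_mul, star_star, mul_assoc]

theorem dW_le_dU (φ ψ : C01 →⋆ₙₐ[ℂ] A) :
    dW (Cu.map φ) (Cu.map ψ) ≤ dU (φ C01.ident) (ψ C01.ident) := by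
  refine le_ciInf fun ⟨u, v⟩ => le_of_forall_pos_le_add fun ε hε => ?_
  set N := ‖(u : StabUnit A) * inStabUnit (φ C01.ident) * star (u : StabUnit A) -
      (v : StabUnit A) * inStabUnit (ψ C01.ident) * star (v : StabUnit A)‖ with hN
  have hN0 : 0 ≤ N := norm_nonneg _
  let r : ℝ≥0 := ⟨N + ε, by positivity⟩
  have hr : N < r := by change N < N + ε; linarith
  have hconj : ∀ (w : unitary (StabUnit A)) (x : StabUnit A),
      ‖star (w : StabUnit A) * x * (w : StabUnit A)‖ = ‖x‖ := by
    intro w x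
    rw [← Unitary.coe_star, CStarRing.norm_mul_coe_unitary, CStarRing.norm_coe_unitary_mul]
  have key : ∀ (u v : unitary (StabUnit A)) (a b : StabUnit A),
      ‖((star u * v : unitary (StabUnit A)) : StabUnit A) * b *
        star ((star u * v : unitary (StabUnit A)) : StabUnit A) - a‖ =
      ‖(u : StabUnit A) * a * star (u : StabUnit A) -
      (v : StabUnit A) * b * star (v : StabUnit A)‖ := by
    intro u v a b
    rw [norm_sub_rev (u * a * star (u : StabUnit A)), ← hconj u (_ - u * a * star (u : StabUnit A))]
    congr 1
    have h1 : star (u : StabUnit A) * u = 1 := Unitary.coe_star_mul_self u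
    have h2 : star (u : StabUnit A) * (u * a * star (u : StabUnit A)) * u = a := by
      calc _ = (star (u : StabUnit A) * u) * a * (star (u : StabUnit A) * u) := by
            simp only [mul_assoc]
        _ = a := by rw [h1, one_mul, mul_one]
    rw [mul_sub, sub_mul, h2]
    simp [mul_assoc]
  refine NNReal.coe_le_coe.2 (csInf_le (OrderBot.bddBelow _) (?_ : r ∈ _))
  intro t
  rw [Cu.map_cuE_le_iff, Cu.map_cuE_le_iff]
  constructor
  · refine cuntzLE_e_of_norm_lt φ ψ (star u * v) ?_
    rw [key]; exact hr
  · refine cuntzLE_e_of_norm_lt ψ φ (star v * u) ?_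
    rw [key, norm_sub_rev]; exact hr

end Distance

/-! ### From Cuntz comparison to exact factorization -/

section Factor

variable {A : Type u} [NonUnitalCStarAlgebra A]

/-- A comparison up to `δ` becomes an exact equality after a cut-down by `2δ`: one `δ` absorbs the
error and the other is the margin in the denominator. Since the approximants of `z` begin with
`ψ((e_s)^(1/2))`, every `G` that is `1` on `[s, ∞)` acts as a left unit on `z`. -/
theorem exists_star_mul_self_eq_of_cuntzLE (φ ψ : C01 →⋆ₙₐ[ℂ] A) {s t : ℝ≥0}
    (h : CuntzLE (φ (C01.e t)) (ψ (C01.e s))) {δ : ℝ} (hδ : 0 < δ)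
    {F G : ℝ → ℝ} (hF : Continuous F) (hFnn : ∀ x, 0 ≤ F x) (hF0 : ∀ x ≤ t + 2 * δ, F x = 0)
    (F0 : F 0 = 0) (hG : Continuous G) (G0 : G 0 = 0) (hG1 : ∀ x : ℝ, s ≤ x → G x = 1) :
    ∃ z : A, star z * z = φ (C01.ofReal F hF F0) ∧ ψ (C01.ofReal G hG G0) * z = z := by
  obtain ⟨D, hD⟩ := cuntzLE_iff.1 h δ hδ
  let q : C01 := C01.ofReal (fun x => √(max (x - s) 0)) (by fun_prop) (by simp)
  have hqq : star q * q = C01.e s := by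
    rw [(C01.isSelfAdjoint_ofReal _ _ _).star_eq]
    exact C01.ofReal_mul_ofReal _ _ _ _ _ _ fun x _ _ => Real.mul_self_sqrt (le_max_right _ _)
  have hGq : C01.ofReal G hG G0 * q = q := by
    refine C01.ofReal_mul_ofReal _ _ _ _ _ _ fun x _ _ => ?_
    rcases le_total (s : ℝ) x with hx | hx
    · rw [hG1 x hx, one_mul]
    · rw [max_eq_right (by linarith), Real.sqrt_zero, mul_zero]
  let Φ := (Unitization.inrNonUnitalStarAlgHom ℂ A).comp φ
  let y : A := ψ q * D
  have hy : star y * y = star D * ψ (C01.e s) * D := by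
    simp only [y, star_mul, ← hqq, map_mul, map_star, mul_assoc]
  have hnorm : ‖Φ (C01.e t) - star (y : Unitization ℂ A) * y‖ ≤ δ := by
    rw [← Unitization.inr_star, ← Unitization.inr_mul, hy]
    change ‖((φ (C01.e t) : A) : Unitization ℂ A) - _‖ ≤ δ
    rw [← Unitization.inr_sub, Unitization.norm_inr, norm_sub_rev]
    exact hD.le
  obtain ⟨k, d, hk, hd⟩ := exists_tendsto_of_norm_e_sub_le Φ hδ.le hδ hnorm hF hFnn
    (fun x hx => hF0 x (by linarith)) F0
  have hiso := (Unitization.isometry_inr (𝕜 := ℂ) (A := A))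
  have hmem : d ∈ Set.range ((↑) : A → Unitization ℂ A) := by
    refine hiso.isClosedEmbedding.isClosed_range.mem_of_tendsto hk (Eventually.of_forall fun n => ?_)
    obtain ⟨c, hc⟩ := exists_inr_mul_inr ((y : Unitization ℂ A) * k n)
      (φ (C01.ofReal (fun x => √(F x)) (by fun_prop) (by simp [F0])))
    exact ⟨c, hc.symm⟩
  obtain ⟨z, rfl⟩ := hmem
  refine ⟨z, ?_, ?_⟩
  · exact hiso.injective (by rw [Unitization.inr_mul, Unitization.inr_star, hd]; rfl)
  · refine hiso.injective ?_
    rw [Unitization.inr_mul]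
    refine tendsto_nhds_unique (hk.const_mul _) (hk.congr fun n => ?_)
    have : (ψ (C01.ofReal G hG G0) : Unitization ℂ A) * (y : Unitization ℂ A) = y := by
      rw [← Unitization.inr_mul]
      simp only [y]
      rw [← mul_assoc, ← map_mul, hGq]
    rw [← mul_assoc, ← mul_assoc, this]

end Factor

/-! ### Approximate unitary equivalence of `x* x` and `x x*` -/

section ApproxUnitEquiv

variable {B : Type u} [CStarAlgebra B]

/-- Approximate unitary equivalence in a unital C*-algebra. -/
def ApproxUnitEquiv (a b : B) : Prop :=
  ∀ ε > 0, ∃ u : unitary B, ‖star (u : B) * a * (u : B) - b‖ < ε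

lemma norm_star_coe_unitary_mul_mul (u : unitary B) (x : B) : ‖star (u : B) * x * (u : B)‖ = ‖x‖ := by
  rw [← Unitary.coe_star, CStarRing.norm_mul_coe_unitary, CStarRing.norm_coe_unitary_mul]

lemma ApproxUnitEquiv.trans {a b c : B} (h₁ : ApproxUnitEquiv a b) (h₂ : ApproxUnitEquiv b c) :
    ApproxUnitEquiv a c := by
  intro ε hε
  obtain ⟨u, hu⟩ := h₁ (ε / 2) (by positivity)
  obtain ⟨v, hv⟩ := h₂ (ε / 2) (by positivity)
  refine ⟨u * v, ?_⟩
  have h : star ((u * v : unitary B) : B) * a * ((u * v : unitary B) : B) - c =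
      star (v : B) * (star (u : B) * a * u - b) * v + (star (v : B) * b * v - c) := by
    rw [Submonoid.coe_mul, star_mul]
    noncomm_ring
  rw [h]
  refine (norm_add_le _ _).trans_lt ?_
  rw [norm_star_coe_unitary_mul_mul]
  linarith

lemma ApproxUnitEquiv.symm {a b : B} (h : ApproxUnitEquiv a b) : ApproxUnitEquiv b a := by
  intro ε hε
  obtain ⟨u, hu⟩ := h ε hε
  refine ⟨star u, lt_of_eq_of_lt ?_ hu⟩
  have h1 : star (u : B) * (u : B) = 1 := Unitary.coe_star_mul_self u
  have h2 : star (u : B) * (u * b * star (u : B)) * u = b := by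
    calc _ = (star (u : B) * u) * b * (star (u : B) * u) := by simp only [mul_assoc]
      _ = b := by rw [h1, one_mul, mul_one]
  rw [Unitary.coe_star, star_star, ← norm_star_coe_unitary_mul_mul u, norm_sub_rev, mul_sub, sub_mul,
    h2]

lemma ApproxUnitEquiv.smul {a b : B} (h : ApproxUnitEquiv a b) (c : ℂ) :
    ApproxUnitEquiv (c • a) (c • b) := by
  intro ε hε
  obtain ⟨u, hu⟩ := h (ε / (‖c‖ + 1)) (by positivity)
  refine ⟨u, ?_⟩
  rw [mul_smul_comm, smul_mul_assoc, ← smul_sub, norm_smul]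
  rw [lt_div_iff₀ (by positivity)] at hu
  nlinarith [norm_nonneg (star (u : B) * a * u - b)]

/-- `W = (c + δ²)^(-1/2)`. It normalizes `T + iδ` to a unitary when `T` is self-adjoint and `c =
T²`. -/
lemma exists_mul_mul_add_smul_eq_one [PartialOrder B] [StarOrderedRing B] {c : B} (hc : 0 ≤ c)
    {δ : ℝ} (hδ : 0 < δ) :
    ∃ W : B, star W = W ∧ (∀ b, Commute c b → Commute W b) ∧
      W * c * W + ((δ ^ 2 : ℝ) : ℂ) • (W * W) = 1 ∧ ‖W * (c * c) * W‖ ≤ ‖c‖ := by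
  have hspec : ∀ t ∈ spectrum ℝ c, 0 ≤ t := fun t ht => spectrum_nonneg_of_nonneg hc ht
  have hsa := hc.isSelfAdjoint
  let g : ℝ → ℝ := fun t => 1 / √(t + δ ^ 2)
  have hpos : ∀ t : ℝ, 0 ≤ t → 0 < t + δ ^ 2 := fun t ht => by positivity
  have hg : ContinuousOn g (spectrum ℝ c) :=
    ContinuousOn.div (by fun_prop) (by fun_prop) fun t ht => (Real.sqrt_pos.2 (hpos t (hspec t ht))).ne'
  have hg2 : ContinuousOn (fun t => g t * g t) (spectrum ℝ c) := hg.mul hg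
  refine ⟨cfc g c, (cfc_predicate g c : IsSelfAdjoint _), fun b hb => hb.cfc_real g, ?_, ?_⟩
  · rw [Complex.coe_smul, cfc_mul_self_mul_cfc hsa hg, ← cfc_mul g g c hg hg,
      ← cfc_smul (δ ^ 2) (fun t => g t * g t) c hg2,
      ← cfc_add _ (fun t => g t * t * g t) (fun t => δ ^ 2 • (g t * g t))
        ((hg.mul (by fun_prop)).mul hg) (hg2.fun_const_smul _),
      ← cfc_one ℝ c]
    refine cfc_congr fun t ht => ?_
    have h0 := hpos t (hspec t ht)
    have h1 : √(t + δ ^ 2) ≠ 0 := (Real.sqrt_pos.2 h0).ne'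
    have h2 := Real.mul_self_sqrt h0.le
    simp only [g, smul_eq_mul, Pi.one_apply]
    field_simp
    rw [Real.sq_sqrt h0.le]
  · have h3 : cfc (fun t => g t * t) c = cfc g c * c := by
      rw [cfc_mul g (fun t => t) c hg (by fun_prop), cfc_id' ℝ c hsa]
    have h4 : cfc (fun t => t * g t) c = c * cfc g c := by
      rw [cfc_mul (fun t => t) g c (by fun_prop) hg, cfc_id' ℝ c hsa]
    have h2 : cfc g c * (c * c) * cfc g c = cfc (fun t => (g t * t) * (t * g t)) c := by
      rw [cfc_mul (fun t => g t * t) (fun t => t * g t) c (hg.mul (by fun_prop))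
        (ContinuousOn.mul (by fun_prop) hg), h3, h4]
      simp only [mul_assoc]
    rw [h2]
    refine norm_cfc_le (norm_nonneg _) fun t ht => ?_
    have ht0 := hspec t ht
    have h0 := hpos t ht0
    have hle : t ≤ ‖c‖ := by
      have hmem : t ∈ spectrum ℝ c := ht
      rcases subsingleton_or_nontrivial B with hB | hB
      · simp [spectrum.of_subsingleton] at hmem
      exact (le_abs_self t).trans (spectrum.norm_le_norm_of_mem ht)
    have h5 : g t * t * (t * g t) = t * t / (t + δ ^ 2) := by
      simp only [g]
      have h1 : √(t + δ ^ 2) ≠ 0 := (Real.sqrt_pos.2 h0).ne'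
      field_simp
      rw [Real.sq_sqrt h0.le]
    rw [h5, Real.norm_of_nonneg (by positivity), div_le_iff₀ h0]
    nlinarith [norm_nonneg c, sq_nonneg δ]

/-- If `x² = 0`, then `x* x` and `x x*` are approximately unitarily equivalent. -/
theorem approxUnitEquiv_of_mul_self_eq_zero [PartialOrder B] [StarOrderedRing B] {x : B}
    (hx : x * x = 0) : ApproxUnitEquiv (star x * x) (x * star x) := by
  intro ε hε
  have hx' : star x * star x = 0 := by rw [← star_mul, hx, star_zero]
  obtain ⟨T, hT⟩ : ∃ T, T = x + star x := ⟨_, rfl⟩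
  obtain ⟨D, hD⟩ : ∃ D, D = star x * x := ⟨_, rfl⟩
  obtain ⟨D', hD'⟩ : ∃ D', D' = x * star x := ⟨_, rfl⟩
  obtain ⟨c, hc⟩ : ∃ c, c = T * T := ⟨_, rfl⟩
  rw [← hD, ← hD']
  have hTsa : IsSelfAdjoint T := by simp [hT, IsSelfAdjoint, add_comm]
  have hcD : c = D + D' := by
    simp only [hc, hT, mul_add, add_mul, hx, hx', hD, hD']; abel
  have hDD' : D * D' = 0 := by
    simp only [hD, hD', mul_assoc]; rw [← mul_assoc x x, hx]; simp
  have hD'D : D' * D = 0 := by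
    simp only [hD, hD', mul_assoc]; rw [← mul_assoc (star x) (star x), hx']; simp
  have hc0 : 0 ≤ c := hc ▸ hTsa.mul_self_nonneg
  have hδ0 : 0 < ε / (√‖c‖ + 1) := by positivity
  obtain ⟨δ, hδ⟩ : ∃ δ, δ = ε / (√‖c‖ + 1) := ⟨_, rfl⟩
  rw [← hδ] at hδ0
  obtain ⟨W, hWsa, hWcomm, hWW, hWbound⟩ := exists_mul_mul_add_smul_eq_one hc0 hδ0
  have hWT : Commute W T := hWcomm T (by simp [hc, Commute, SemiconjBy, mul_assoc])
  have hWD : Commute W D := hWcomm D (by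
    simp [hcD, Commute, SemiconjBy, mul_add, add_mul, hDD', hD'D])
  obtain ⟨z, hz⟩ : ∃ z : ℂ, z = Complex.I * δ := ⟨_, rfl⟩
  have hzstar : star z = -z := by simp [hz]
  have hzz : z * z = -((δ ^ 2 : ℝ) : ℂ) := by
    rw [hz]; push_cast; linear_combination (δ : ℂ) ^ 2 * Complex.I_mul_I
  -- `U = (T + iδ)(T² + δ²)^(-1/2)` is unitary, and `T` intertwines `x* x` and `x x*` exactly,
  -- because `x² = 0`. Only the term with `iδ` contributes an error.
  obtain ⟨U, hU⟩ : ∃ U, U = T * W + z • W := ⟨_, rfl⟩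
  have hUstar : star U = W * T - z • W := by
    rw [hU, star_add, star_mul, star_smul, hWsa, hTsa.star_eq, hzstar, neg_smul, sub_eq_add_neg]
  have hUU : star U * U = 1 := by
    rw [hUstar, hU, ← hWW, hc]
    simp only [sub_mul, mul_add, smul_sub, smul_mul_assoc, mul_smul_comm, smul_smul, hzz, neg_smul,
      mul_assoc]
    abel
  have hUU' : U * star U = 1 := by
    rw [hUstar, hU, ← hWT.eq, ← hWW, hc]
    simp only [add_mul, mul_sub, smul_add, smul_mul_assoc, mul_smul_comm, smul_smul, hzz, neg_smul,
      mul_assoc, hWT.eq, hWT.left_comm]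
    abel
  have hUmem : star U ∈ unitary B := by
    rw [Unitary.mem_iff, star_star]; exact ⟨hUU', hUU⟩
  have hTD : T * D = D' * T := by
    simp only [hT, hD, hD', add_mul, mul_add, mul_assoc, hx']
    rw [← mul_assoc (star x) (star x), hx']
    simp
  have hdiff : U * D - D' * U = z • ((D - D') * W) := by
    rw [hU, add_mul, mul_add, mul_assoc, hWD.eq, ← mul_assoc, hTD, smul_mul_assoc, hWD.eq,
      mul_smul_comm, sub_mul, smul_sub, mul_assoc]
    abel
  -- `D` and `D'` are orthogonal, so `(D - D')² = (D + D')²`. The error is therefore at most `δ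
  -- ‖c‖^(1/2)`, which is below `ε` by the choice of `δ`.
  have hsq : (D - D') * (D - D') = c * c := by
    rw [hcD]
    simp only [mul_sub, sub_mul, mul_add, add_mul, hDD', hD'D]
    abel
  have hDsa : star (D - D') = D - D' := by simp [hD, hD']
  have hbound : ‖(D - D') * W‖ ≤ √‖c‖ := by
    refine Real.le_sqrt_of_sq_le ?_
    have h1 : star ((D - D') * W) * ((D - D') * W) = W * (c * c) * W := by
      rw [star_mul, hDsa, hWsa, ← hsq]; simp only [mul_assoc]
    rw [sq, ← CStarRing.norm_star_mul_self, h1]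
    exact hWbound
  refine ⟨⟨star U, hUmem⟩, ?_⟩
  have h6 : star (star U) * D * star U - D' = (U * D - D' * U) * star U := by
    rw [star_star, sub_mul, mul_assoc D', hUU', mul_one]
  change ‖star (star U) * D * star U - D'‖ < ε
  have h7 : ‖(U * D - D' * U) * star U‖ = ‖U * D - D' * U‖ :=
    CStarRing.norm_mul_coe_unitary _ (⟨star U, hUmem⟩ : unitary B)
  rw [h6, h7, hdiff, norm_smul, hz, norm_mul, Complex.norm_I, one_mul, Complex.norm_real,
    Real.norm_of_nonneg hδ0.le, hδ, div_mul_eq_mul_div, div_lt_iff₀ (by positivity)]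
  nlinarith

end ApproxUnitEquiv

section Stable

variable {A : Type u} [NonUnitalCStarAlgebra A]

lemma stablyApproxUnitEquiv_iff {a b : A} :
    StablyApproxUnitEquiv a b ↔ ApproxUnitEquiv (inStabUnit a) (inStabUnit b) := by
  constructor
  · rintro ⟨u, hu⟩ ε hε
    obtain ⟨N, hN⟩ := Metric.tendsto_atTop.1 hu ε hε
    exact ⟨u N, by simpa [dist_eq_norm] using hN N le_rfl⟩
  · intro h
    choose u hu using fun n : ℕ => h (1 / ((n : ℝ) + 1)) (by positivity)
    exact ⟨u, tendsto_iff_norm_sub_tendsto_zero.2 (squeeze_zero (fun _ => norm_nonneg _)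
      (fun n => (hu n).le) tendsto_one_div_add_atTop_nhds_zero_nat)⟩

lemma StablyApproxUnitEquiv.trans {a b c : A} (h₁ : StablyApproxUnitEquiv a b)
    (h₂ : StablyApproxUnitEquiv b c) : StablyApproxUnitEquiv a c := by
  rw [stablyApproxUnitEquiv_iff] at *
  exact h₁.trans h₂

lemma StablyApproxUnitEquiv.smul {a b : A} (h : StablyApproxUnitEquiv a b) (c : ℂ) :
    StablyApproxUnitEquiv (c • a) (c • b) := by
  rw [stablyApproxUnitEquiv_iff, ← inStabUnitHom_apply, ← inStabUnitHom_apply] at *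
  rw [map_smul, map_smul]
  exact h.smul c

lemma ofMatrix_apply {α m n : Type*} (f : m → n → α) (i : m) (j : n) :
    CStarMatrix.ofMatrix f i j = f i j := rfl

/-- The element `a ⊗ e₁₀` of `A ⊗ 𝓚`. -/
def belowCorner (a : A) : Stab A :=
  toStab (FinMat.of A 2 (CStarMatrix.ofMatrix fun i j => if i = 1 ∧ j = 0 then a else 0))

lemma belowCorner_mul_belowCorner (a : A) : belowCorner a * belowCorner a = 0 := by
  rw [belowCorner, ← toStab_mul, ← map_mul, ← toStab_zero, ← map_zero (FinMat.of A 2)]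
  congr 2
  ext i j
  simp [CStarMatrix.mul_apply, ofMatrix_apply]

lemma star_belowCorner_mul_belowCorner (a : A) :
    star (belowCorner a) * belowCorner a = corner (star a * a) := by
  rw [belowCorner, ← toStab_star, ← map_star, ← toStab_mul, ← map_mul, corner_eq 1]
  congr 2
  ext i j
  fin_cases i <;> fin_cases j <;>
    simp [CStarMatrix.mul_apply, CStarMatrix.star_apply, pad_apply, oneByOne_apply, ofMatrix_apply]

lemma belowCorner_mul_star_belowCorner (a : A) :
    belowCorner a * star (belowCorner a) = toStab (FinMat.of A 2 (CStarMatrix.ofMatrix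
      fun i j => if i = 1 ∧ j = 1 then a * star a else 0)) := by
  rw [belowCorner, ← toStab_star, ← map_star, ← toStab_mul, ← map_mul]
  congr 2
  ext i j
  fin_cases i <;> fin_cases j <;>
    simp [CStarMatrix.mul_apply, CStarMatrix.star_apply, ofMatrix_apply]

/-- The element `x ⊗ e₁₀` has square zero, so `x* x ⊗ e₀₀` is equivalent to `x x* ⊗ e₁₁`. The same
argument for the positive square root of `x x*` moves `x x* ⊗ e₁₁` back to the corner. -/
theorem stablyApproxUnitEquiv_star_mul_self [PartialOrder A] [StarOrderedRing A] (x : A) :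
    StablyApproxUnitEquiv (star x * x) (x * star x) := by
  rw [stablyApproxUnitEquiv_iff]
  have key : ∀ y : A, ApproxUnitEquiv (inStabUnit (star y * y))
      ((toStab (FinMat.of A 2 (CStarMatrix.ofMatrix
        fun i j => if i = 1 ∧ j = 1 then y * star y else 0)) : Stab A) : StabUnit A) := by
    intro y
    have h := approxUnitEquiv_of_mul_self_eq_zero (x := (belowCorner y : StabUnit A))
      (by rw [← Unitization.inr_mul, belowCorner_mul_belowCorner, Unitization.inr_zero])
    rwa [← Unitization.inr_star, ← Unitization.inr_mul, ← Unitization.inr_mul,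
      star_belowCorner_mul_belowCorner, belowCorner_mul_star_belowCorner] at h
  have hx := key x
  have hy := key (CFC.sqrt (x * star x))
  have hsa : star (CFC.sqrt (x * star x)) = CFC.sqrt (x * star x) :=
    (CFC.sqrt_nonneg _).isSelfAdjoint
  rw [hsa, CFC.sqrt_mul_sqrt_self _ (mul_star_self_nonneg x)] at hy
  exact hx.trans hy.symm

end Stable

/-! ### Property (I) for weighted sums along a chain -/

section Chain

variable {A : Type u} [NonUnitalCStarAlgebra A]

/-- The elements on which `p` acts as a two-sided unit form a closed *-subalgebra, which contains
`q` and hence `f(q)`. -/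
lemma mul_cfcₙ_eq_of_mul_eq {p q : A} (hp : IsSelfAdjoint p) (hpq : p * q = q)
    (hqp : q * p = q) (f : ℝ → ℝ) : p * cfcₙ f q = cfcₙ f q ∧ cfcₙ f q * p = cfcₙ f q := by
  let S : NonUnitalStarSubalgebra ℝ A :=
    { carrier := {d | p * d = d ∧ d * p = d}
      mul_mem' := fun {a b} ha hb => ⟨by rw [← mul_assoc, ha.1], by rw [mul_assoc, hb.2]⟩
      add_mem' := fun {a b} ha hb => ⟨by rw [mul_add, ha.1, hb.1], by rw [add_mul, ha.2, hb.2]⟩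
      zero_mem' := ⟨mul_zero _, zero_mul _⟩
      smul_mem' := fun r {a} ha => ⟨by rw [mul_smul_comm, ha.1], by rw [smul_mul_assoc, ha.2]⟩
      star_mem' := fun {a} ha => ⟨by rw [← hp.star_eq, ← star_mul, ha.2],
        by rw [← hp.star_eq, ← star_mul, ha.1]⟩ }
  have hS : IsClosed (S : Set A) :=
    (isClosed_eq (continuous_const.mul continuous_id) continuous_id).inter
      (isClosed_eq (continuous_id.mul continuous_const) continuous_id)
  have : IsClosed (S : Set A) := hS
  exact cfcₙ_mem (s := S) f (show q ∈ S from ⟨hpq, hqp⟩)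

/-- `h = (1 + μq)^(1/2) - 1`, that is, `(1 + h)² = 1 + μq`, written without the unit of the
unitization. -/
lemma exists_add_add_mul_self_eq_smul [PartialOrder A] [StarOrderedRing A] {p q : A}
    (hp : IsSelfAdjoint p) (hq : 0 ≤ q) (hpq : p * q = q) (hqp : q * p = q) {μ : ℝ} (hμ : 0 ≤ μ) :
    ∃ h : A, star h = h ∧ h + h + h * h = μ • q ∧ p * h = h ∧ h * p = h := by
  have hspec : ∀ t ∈ quasispectrum ℝ q, 0 ≤ t := fun t ht => quasispectrum_nonneg_of_nonneg q hq t ht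
  let f : ℝ → ℝ := fun t => √(1 + μ * t) - 1
  have hf : Continuous f := by fun_prop
  have f0 : f 0 = 0 := by simp [f]
  refine ⟨cfcₙ f q, cfcₙ_predicate f q, ?_, mul_cfcₙ_eq_of_mul_eq hp hpq hqp f⟩
  rw [← cfcₙ_add f f q, ← cfcₙ_mul f f q,
    ← cfcₙ_add (fun t => f t + f t) (fun t => f t * f t) q]
  conv_rhs => rw [← cfcₙ_id' ℝ q]
  rw [← cfcₙ_smul μ (fun t => t) q]
  refine cfcₙ_congr fun t ht => ?_
  have := Real.mul_self_sqrt (show 0 ≤ 1 + μ * t by have := hspec t ht; positivity)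
  simp only [f, smul_eq_mul]
  linear_combination this

open Finset in
-- Induction on `n`: property (I) moves the last term `x_{n+1}* x_{n+1}` under `x_n`, to `x_n* q
-- x_n` with `q = x_{n+1} x_{n+1}*`. There it merges with the term of `x_n` into one term `x'* x'`,
-- where `x' = (1 + h) x_n`. The shorter chain ending in `x'` satisfies the hypotheses again, and
-- `x' x'*` splits into the last two required terms. The last element of the chain carries no norm
-- bound, since `x'` need not be a contraction.
theorem PropertyI.stablyApproxUnitEquiv_sum [PartialOrder A] [StarOrderedRing A]
    (hI : PropertyI A) {w : ℕ → ℝ} (hw : ∀ k, 0 < w k) (n : ℕ) :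
    ∀ x : ℕ → A, (∀ k < n, ‖x k‖ ≤ 1) → (∀ k < n, x (k + 1) * (star (x k) * x k) = x (k + 1)) →
      (∀ k < n, x k * star (x k) * x (k + 1) = x (k + 1)) →
      StablyApproxUnitEquiv (∑ k ∈ range (n + 1), (w k : ℂ) • (star (x k) * x k))
        (∑ k ∈ range (n + 1), (w k : ℂ) • (x k * star (x k))) := by
  induction n with
  | zero =>
    intro x _ _ _
    simpa using (stablyApproxUnitEquiv_star_mul_self (x 0)).smul (w 0)
  | succ n ih =>
    intro x hx h1 h2
    have h1' : ∀ j ≤ n + 1, ∀ k < j, x j * (star (x k) * x k) = x j := by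
      intro j
      induction j with
      | zero => intro _ k hk; omega
      | succ j ihj =>
        intro hj k hk
        rcases Nat.lt_succ_iff_lt_or_eq.1 hk with hk | rfl
        · have h := ihj (by omega) k hk
          rw [← h1 j (by omega)]
          simp only [mul_assoc] at h ⊢
          rw [h]
        · exact h1 k (by omega)
    set p : ℕ → A := fun k => star (x k) * x k with hp
    have hpsa : ∀ k, star (p k) = p k := fun k => by simp [hp]
    set S := ∑ k ∈ range (n + 1), w k with hS
    have hS0 : 0 < S := sum_pos (fun k _ => hw k) ⟨0, by simp⟩
    set s := ∑ k ∈ range (n + 1), (w k : ℂ) • p k with hs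
    -- Normalized by the total weight `S`, the sum of the earlier terms is a positive contraction.
    -- It acts as a unit on `y` because each `p_k` with `k ≤ n` does.
    set e : A := ((S⁻¹ : ℝ) : ℂ) • s with he
    -- The scaling is chosen so that `S y* y = w_{n+1} p_{n+1}`.
    set c : ℝ := √(w (n + 1) / S) with hc
    have hcc : c * c = w (n + 1) / S := Real.mul_self_sqrt (div_nonneg (hw _).le hS0.le)
    set y : A := (c : ℂ) • (star (x n) * x (n + 1)) with hy
    have hyp : ∀ k ≤ n, y * p k = y := by
      intro k hk
      rw [hy, smul_mul_assoc, mul_assoc, h1' (n + 1) le_rfl k (by omega)]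
    have hpy : ∀ k ≤ n, p k * y = y := by
      intro k hk
      rw [hy, mul_smul_comm]
      congr 1
      rcases hk.lt_or_eq with hk | rfl
      · have := congrArg star (h1' n (by omega) k hk)
        rw [star_mul, hpsa] at this
        rw [← mul_assoc, this]
      · have := h2 k (by omega)
        simp only [hp, mul_assoc] at this ⊢
        rw [this]
    have hsy : s * y = (S : ℂ) • y := by
      rw [hs, sum_mul, hS, Complex.ofReal_sum, sum_smul]
      refine sum_congr rfl fun k hk => ?_
      rw [smul_mul_assoc, hpy k (by simpa [Nat.lt_succ_iff] using hk)]
    have hys : y * s = (S : ℂ) • y := by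
      rw [hs, mul_sum, hS, Complex.ofReal_sum, sum_smul]
      refine sum_congr rfl fun k hk => ?_
      rw [mul_smul_comm, hyp k (by simpa [Nat.lt_succ_iff] using hk)]
    have hSS : ((S⁻¹ : ℝ) : ℂ) * (S : ℂ) = 1 := by
      rw [← Complex.ofReal_mul, inv_mul_cancel₀ hS0.ne', Complex.ofReal_one]
    have hSS' : (S : ℂ) * ((S⁻¹ : ℝ) : ℂ) = 1 := by rw [mul_comm, hSS]
    have hey : e * y = y := by
      rw [he, smul_mul_assoc, hsy, smul_smul, hSS, one_smul]
    have hye : y * e = y := by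
      rw [he, mul_smul_comm, hys, smul_smul, hSS, one_smul]
    have hs0 : 0 ≤ s := sum_nonneg fun k _ => by
      rw [Complex.coe_smul]; exact smul_nonneg (hw k).le (star_mul_self_nonneg _)
    have he0 : 0 ≤ e := by
      rw [he, Complex.coe_smul]; exact smul_nonneg (inv_nonneg.2 hS0.le) hs0
    have hpnorm : ∀ k ≤ n, ‖p k‖ ≤ 1 := by
      intro k hk
      rw [hp, CStarRing.norm_star_mul_self]
      have := hx k (by omega)
      nlinarith [norm_nonneg (x k)]
    have hsnorm : ‖s‖ ≤ S := by
      refine (norm_sum_le _ _).trans (sum_le_sum fun k hk => ?_)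
      rw [norm_smul, Complex.norm_real, Real.norm_of_nonneg (hw k).le]
      exact mul_le_of_le_one_right (hw k).le (hpnorm k (by simpa [Nat.lt_succ_iff] using hk))
    have henorm : ‖e‖ ≤ 1 := by
      rw [he, norm_smul, Complex.norm_real, Real.norm_of_nonneg (inv_nonneg.2 hS0.le),
        inv_mul_le_iff₀ hS0, mul_one]
      exact hsnorm
    have hstep := (hI y e he0 henorm hey hye).smul (S : ℂ)
    have hccS : (S : ℂ) * ((c : ℂ) * (c : ℂ)) = w (n + 1) := by
      rw [← Complex.ofReal_mul, hcc, ← Complex.ofReal_mul, mul_div_cancel₀ _ hS0.ne']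
    have hSe : (S : ℂ) • e = s := by rw [he, smul_smul, hSS', one_smul]
    set q := x (n + 1) * star (x (n + 1)) with hq
    have hl : (S : ℂ) • (star y * y + e) = ∑ k ∈ range (n + 1 + 1), (w k : ℂ) • p k := by
      rw [sum_range_succ, smul_add, hSe, add_comm]
      congr 1
      have : star y * y = ((c : ℂ) * c) • p (n + 1) := by
        rw [hy, star_smul, smul_mul_smul_comm, star_mul, star_star]
        have h := h2 n (by omega)
        simp only [hp, mul_assoc] at h ⊢
        rw [h]
        simp
      rw [this, smul_smul, hccS]
    obtain ⟨h, hhsa, hhq, hqh, hhq'⟩ := exists_add_add_mul_self_eq_smul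
      (p := x n * star (x n)) (q := q) (IsSelfAdjoint.mul_star_self _) (mul_star_self_nonneg _)
      (by rw [hq, ← mul_assoc, h2 n (by omega)])
      (by
        have := congrArg star (h2 n (by omega))
        simp only [star_mul, star_star] at this
        rw [hq, mul_assoc, this])
      (μ := w (n + 1) / w n) (div_nonneg (hw _).le (hw _).le)
    set x' : A := x n + h * x n with hx'
    have hwn : (w n : ℂ) ≠ 0 := Complex.ofReal_ne_zero.2 (hw n).ne'
    have hμ : (w n : ℂ) • (h + h + h * h) = (w (n + 1) : ℂ) • q := by
      rw [hhq, ← Complex.coe_smul, smul_smul, Complex.ofReal_div, mul_div_cancel₀ _ hwn]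
    have hx'1 : star x' * x' = star (x n) * x n + star (x n) * (h + h + h * h) * x n := by
      rw [hx', star_add, star_mul, hhsa]
      noncomm_ring
    -- Here `x_n x_n*` is a unit for `h`, so `(1 + h) x_n x_n* (1 + h)` is `x_n x_n*` plus `2h +
    -- h²`, the latter being a multiple of `q`.
    have hx'2 : x' * star x' = x n * star (x n) + (h + h + h * h) := by
      have e1 : h * x n * star (x n) = h := by rw [mul_assoc, hhq']
      have e2 : x n * (star (x n) * h) = h := by rw [← mul_assoc, hqh]
      rw [hx', star_add, star_mul, hhsa]
      simp only [mul_add, add_mul, e1, e2]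
      rw [← mul_assoc (h * x n), e1]
      abel
    have hr : (S : ℂ) • (y * star y + e) = ∑ k ∈ range n, (w k : ℂ) • p k +
        (w n : ℂ) • (star x' * x') := by
      have hmid : (w n : ℂ) • (star (x n) * (h + h + h * h) * x n) =
          (w (n + 1) : ℂ) • (star (x n) * q * x n) := by
        rw [← smul_mul_assoc, ← mul_smul_comm, hμ, mul_smul_comm, smul_mul_assoc]
      rw [hx'1, smul_add, hSe, hs, sum_range_succ, smul_add, hmid, add_comm, add_assoc]
      congr 2
      have : y * star y = ((c : ℂ) * c) • (star (x n) * q * x n) := by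
        rw [hy, star_smul, smul_mul_smul_comm, star_mul, star_star]
        simp [hq, mul_assoc]
      rw [this, smul_smul, hccS]
    let X : ℕ → A := Function.update x n x'
    have hX : ∀ k < n, X k = x k := fun k hk => Function.update_of_ne hk.ne _ _
    have hXn : X n = x' := Function.update_self ..
    have hih := ih X (fun k hk => by rw [hX k hk]; exact hx k (by omega))
      (fun k hk => by
        rw [hX k hk]
        rcases (Nat.succ_le_of_lt hk).lt_or_eq with hk' | hk'
        · rw [hX _ hk']; exact h1 k (by omega)
        · have hk1 : k + 1 = n := hk'
          rw [hk1, hXn, hx', add_mul, mul_assoc, h1' n (by omega) k hk])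
      (fun k hk => by
        rw [hX k hk]
        rcases (Nat.succ_le_of_lt hk).lt_or_eq with hk' | hk'
        · rw [hX _ hk']; exact h2 k (by omega)
        · have hk1 : k + 1 = n := hk'
          have h3 := h2 k (by omega)
          rw [hk1] at h3
          have h4 : x k * star (x k) * h = h := by
            rw [← hqh, ← mul_assoc, ← mul_assoc, h3]
          rw [hk1, hXn, hx', mul_add, h3, ← mul_assoc, h4])
    have hL : ∑ k ∈ range (n + 1), (w k : ℂ) • (star (X k) * X k) =
        ∑ k ∈ range n, (w k : ℂ) • p k + (w n : ℂ) • (star x' * x') := by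
      rw [sum_range_succ, hXn]
      congr 1
      exact sum_congr rfl fun k hk => by rw [hX k (by simpa using hk)]
    have hR : ∑ k ∈ range (n + 1), (w k : ℂ) • (X k * star (X k)) =
        ∑ k ∈ range (n + 1 + 1), (w k : ℂ) • (x k * star (x k)) := by
      rw [sum_range_succ, hXn, sum_range_succ, sum_range_succ, hx'2, smul_add, hμ, ← add_assoc]
      congr 2
      exact sum_congr rfl fun k hk => by rw [hX k (by simpa using hk)]
    rw [hl, hr, ← hL] at hstep
    rw [hR] at hih
    exact hstep.trans hih

end Chain

/-! ### Staircase approximations of the identity function -/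

section Ramp

/-- The continuous function that is `0` on `(-∞, δ]`, `1` on `[2δ, ∞)` and linear in between. -/
def ramp (δ u : ℝ) : ℝ := max 0 (min 1 ((u - δ) / δ))

lemma continuous_ramp (δ : ℝ) : Continuous (ramp δ) := by unfold ramp; fun_prop

lemma ramp_nonneg (δ u : ℝ) : 0 ≤ ramp δ u := le_max_left _ _

lemma ramp_le_one (δ u : ℝ) : ramp δ u ≤ 1 := max_le zero_le_one (min_le_left _ _)

lemma ramp_eq_zero {δ u : ℝ} (hδ : 0 < δ) (hu : u ≤ δ) : ramp δ u = 0 :=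
  max_eq_left ((min_le_right _ _).trans (div_nonpos_of_nonpos_of_nonneg (by linarith) hδ.le))

lemma ramp_eq_one {δ u : ℝ} (hδ : 0 < δ) (hu : 2 * δ ≤ u) : ramp δ u = 1 := by
  have : 1 ≤ (u - δ) / δ := by rw [le_div_iff₀ hδ]; linarith
  rw [ramp, min_eq_left this, max_eq_right zero_le_one]

open Finset in
-- A staircase with steps of height `2ρ` at the odd multiples of `ρ` stays within `ρ` of the
-- diagonal; the width of the ramps costs another `2δ`. In the induction, once `y` passes the next
-- step, all earlier ramps have reached `1`.
lemma abs_sub_sum_ramp_le {δ ρ : ℝ} (hδ : 0 < δ) (hδρ : δ ≤ ρ) (N : ℕ) :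
    ∀ y, -ρ - 2 * δ ≤ y → y ≤ (2 * N + 1) * ρ →
      |y - ∑ j ∈ range N, 2 * ρ * ramp δ (y - (2 * j + 1) * ρ)| ≤ ρ + 2 * δ := by
  induction N with
  | zero =>
    intro y h1 h2
    simp only [range_zero, sum_empty, sub_zero]
    rw [abs_le]
    constructor <;> push_cast at h2 <;> linarith
  | succ N ih =>
    intro y h1 h2
    rw [sum_range_succ]
    rcases le_or_gt y ((2 * N + 1) * ρ) with hy | hy
    · rw [ramp_eq_zero hδ (by linarith), mul_zero, add_zero]
      exact ih y h1 hy
    · have hsum : ∑ j ∈ range N, 2 * ρ * ramp δ (y - (2 * j + 1) * ρ) = 2 * ρ * N := by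
        rw [sum_congr rfl (g := fun _ => 2 * ρ), sum_const, card_range, nsmul_eq_mul, mul_comm]
        intro j hj
        have hj' : (j : ℝ) + 1 ≤ N := by exact_mod_cast mem_range.1 hj
        rw [ramp_eq_one hδ, mul_one]
        nlinarith
      rw [hsum]
      have hρ : 0 < ρ := hδ.trans_le hδρ
      push_cast at h2
      have h3 := ramp_nonneg δ (y - (2 * N + 1) * ρ)
      have h4 := ramp_le_one δ (y - (2 * N + 1) * ρ)
      rw [abs_le]
      constructor
      · nlinarith
      · rcases le_or_gt (2 * δ) (y - (2 * N + 1) * ρ) with h5 | h5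
        · rw [ramp_eq_one hδ h5]; nlinarith
        · nlinarith

/-- `levelFun δ ρ k` is the function `x ↦ ramp δ (x - k ρ)`. -/
def levelFun (δ ρ : ℝ) (k : ℕ) (x : ℝ) : ℝ := ramp δ (x - k * ρ)

lemma continuous_levelFun (δ ρ : ℝ) (k : ℕ) : Continuous (levelFun δ ρ k) :=
  (continuous_ramp δ).comp (by fun_prop)

lemma levelFun_zero {δ ρ : ℝ} (hδ : 0 < δ) (hρ : 0 < ρ) (k : ℕ) : levelFun δ ρ k 0 = 0 :=
  ramp_eq_zero hδ (by have : 0 ≤ (k : ℝ) * ρ := by positivity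
                      linarith)

/-- `levelFun δ ρ k` as an element of `C₀(0,1]`. -/
def C01.level {δ ρ : ℝ} (hδ : 0 < δ) (hρ : 0 < ρ) (k : ℕ) : C01 :=
  C01.ofReal (levelFun δ ρ k) (continuous_levelFun δ ρ k) (levelFun_zero hδ hρ k)

lemma C01.norm_level_le {δ ρ : ℝ} (hδ : 0 < δ) (hρ : 0 < ρ) (k : ℕ) :
    ‖C01.level hδ hρ k‖ ≤ 1 :=
  C01.norm_ofReal_le _ _ zero_le_one fun x _ _ => by
    rw [levelFun, abs_of_nonneg (ramp_nonneg _ _)]; exact ramp_le_one _ _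

lemma C01.level_mul_level {δ ρ : ℝ} (hδ : 0 < δ) (hδρ : δ ≤ ρ) (hρ : 0 < ρ) {k l : ℕ}
    (hkl : k < l) : C01.level hδ hρ k * C01.level hδ hρ l = C01.level hδ hρ l := by
  refine C01.ofReal_mul_ofReal _ _ _ _ _ _ fun x _ _ => ?_
  have hkl' : (k : ℝ) + 1 ≤ l := by exact_mod_cast hkl
  simp only [levelFun]
  rcases le_or_gt (x - l * ρ) δ with h | h
  · rw [ramp_eq_zero hδ h, mul_zero]
  · rw [ramp_eq_one hδ (u := x - k * ρ) (by nlinarith), one_mul]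

open Finset in
lemma C01.norm_ident_sub_sum_le (N : ℕ) (w : ℕ → ℝ) (f : ℕ → ℝ → ℝ) (hf : ∀ j, Continuous (f j))
    (f0 : ∀ j, f j 0 = 0) {C : ℝ} (hC : 0 ≤ C)
    (H : ∀ x, 0 < x → x ≤ 1 → |x - ∑ j ∈ range N, w j * f j x| ≤ C) :
    ‖C01.ident - ∑ j ∈ range N, (w j : ℂ) • C01.ofReal (f j) (hf j) (f0 j)‖ ≤ C := by
  have : C01.ident - ∑ j ∈ range N, (w j : ℂ) • C01.ofReal (f j) (hf j) (f0 j) =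
      C01.ofReal (fun x => x - ∑ j ∈ range N, w j * f j x) (by fun_prop) (by simp [f0]) := by
    clear H
    induction N with
    | zero => ext x; simp [C01.ident, C01.ofReal_apply]
    | succ N ih =>
      rw [sum_range_succ, ← sub_sub, ih]
      ext x
      simp [C01.ofReal_apply, sum_range_succ]
      ring
  rw [this]
  exact C01.norm_ofReal_le _ _ hC H

open Finset in
lemma C01.norm_ident_sub_sum_odd_level_le {δ ρ : ℝ} (hδ : 0 < δ) (hδρ : δ ≤ ρ) (hρ : 0 < ρ) (N : ℕ)
    (hN : 1 ≤ (2 * N + 1) * ρ) :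
    ‖C01.ident - ∑ j ∈ range N, ((2 * ρ : ℝ) : ℂ) • C01.level hδ hρ (2 * j + 1)‖ ≤ ρ + 2 * δ := by
  refine C01.norm_ident_sub_sum_le N (fun _ => 2 * ρ) (fun j => levelFun δ ρ (2 * j + 1))
    (fun j => continuous_levelFun _ _ _) (fun j => levelFun_zero hδ hρ _) (by positivity) ?_
  intro x hx hx1
  have := abs_sub_sum_ramp_le hδ hδρ N x (by linarith) (by linarith)
  simpa [levelFun] using this

open Finset in
-- Removing the first step, which has height `ρ` and sits at `0`, leaves the odd staircase evaluated
-- at `x - ρ`. For `x < 2δ` the first ramp may be incomplete, but then no other step has begun.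
lemma C01.norm_ident_sub_sum_even_level_le {δ ρ : ℝ} (hδ : 0 < δ) (hδρ : δ ≤ ρ) (hρ : 0 < ρ) (N : ℕ)
    (hN : 1 ≤ (2 * N + 1) * ρ) :
    ‖C01.ident - ∑ j ∈ range (N + 1), ((if j = 0 then ρ else 2 * ρ : ℝ) : ℂ) •
      C01.level hδ hρ (2 * j)‖ ≤ ρ + 2 * δ := by
  refine C01.norm_ident_sub_sum_le (N + 1) (fun j => if j = 0 then ρ else 2 * ρ)
    (fun j => levelFun δ ρ (2 * j))
    (fun j => continuous_levelFun _ _ _) (fun j => levelFun_zero hδ hρ _) (by positivity) ?_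
  intro x hx hx1
  rw [sum_range_succ']
  have hterm : ∀ j : ℕ, (if j + 1 = 0 then ρ else 2 * ρ) * levelFun δ ρ (2 * (j + 1)) x =
      2 * ρ * ramp δ ((x - ρ) - (2 * j + 1) * ρ) := by
    intro j
    rw [if_neg (by omega), levelFun]
    congr 2
    push_cast
    ring
  simp only [hterm]
  have h0 : levelFun δ ρ (2 * 0) x = ramp δ x := by simp [levelFun]
  rw [h0, if_pos trivial]
  rcases le_or_gt (2 * δ) x with h | h
  · rw [ramp_eq_one hδ h]
    have := abs_sub_sum_ramp_le hδ hδρ N (x - ρ) (by linarith) (by linarith)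
    convert this using 2
    ring
  · have hz : ∑ j ∈ range N, 2 * ρ * ramp δ ((x - ρ) - (2 * j + 1) * ρ) = 0 := by
      refine sum_eq_zero fun j _ => ?_
      rw [ramp_eq_zero hδ, mul_zero]
      have : 0 ≤ (j : ℝ) * ρ := by positivity
      nlinarith
    rw [hz, zero_add, abs_le]
    have h3 := ramp_nonneg δ x
    have h4 := ramp_le_one δ x
    constructor <;> nlinarith

end Ramp

/-- `(xp - x)* (xp - x) = pqp - pq - qp + q = 0`. -/
lemma mul_eq_self_of_star_mul_self_mul_eq {A : Type u} [NonUnitalCStarAlgebra A] {x p q : A} (hp : IsSelfAdjoint p) (hx : star x * x = q)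
    (hqp : q * p = q) : x * p = x := by
  have hqsa : star q = q := by rw [← hx]; simp
  have hpq : p * q = q := by
    have := congrArg star hqp
    rwa [star_mul, hqsa, hp.star_eq] at this
  rw [← sub_eq_zero, ← CStarRing.star_mul_self_eq_zero_iff]
  have : star (x * p - x) * (x * p - x) =
      p * (star x * x) * p - p * (star x * x) - (star x * x) * p + star x * x := by
    rw [star_sub, star_mul, hp.star_eq]; noncomm_ring
  rw [this, hx, hpq, hqp]
  abel

/-! ### Alternating sums of decreasing positive elements -/

section OrderBound

variable {A : Type u} [NonUnitalCStarAlgebra A] [PartialOrder A] [StarOrderedRing A]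

lemma norm_le_one_of_neg_le_of_le {d q : A} (hq : 0 ≤ q) (hq1 : ‖q‖ ≤ 1) (h1 : -q ≤ d) (h2 : d ≤ q) :
    ‖d‖ ≤ 1 := by
  have hqsa : IsSelfAdjoint q := hq.isSelfAdjoint
  have hd : IsSelfAdjoint d := by
    have := (IsSelfAdjoint.of_nonneg (sub_nonneg.2 h2))
    have h3 := hqsa.sub this
    rwa [sub_sub_cancel] at h3
  have hq1' : (q : Unitization ℂ A) ≤ algebraMap ℝ _ 1 := by
    rw [← CStarAlgebra.norm_le_iff_le_algebraMap _ zero_le_one (Unitization.inr_nonneg_iff.2 hq),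
      Unitization.norm_inr]
    exact hq1
  have hd2 : (d : Unitization ℂ A) ≤ algebraMap ℝ _ 1 :=
    ((Unitization.inr_le_iff d q hd hqsa).2 h2).trans hq1'
  have hd1 : algebraMap ℝ (Unitization ℂ A) (-1) ≤ d := by
    have := (Unitization.inr_le_iff (-q) d hqsa.neg hd).2 h1
    rw [map_neg]
    refine (neg_le_neg hq1').trans ?_
    rwa [← Unitization.inr_neg]
  have hdsa : IsSelfAdjoint (d : Unitization ℂ A) := hd.inr _
  rw [← Unitization.norm_inr (𝕜 := ℂ), ← cfc_id' ℝ (d : Unitization ℂ A) hdsa]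
  refine norm_cfc_le zero_le_one fun t ht => ?_
  rw [Real.norm_eq_abs, abs_le]
  exact ⟨(algebraMap_le_iff_le_spectrum hdsa).1 hd1 t ht, (le_algebraMap_iff_spectrum_le hdsa).1 hd2 t ht⟩

open Finset in
-- The difference equals `ρ (Q_0 - 2R)`, where `R` is the sum of the gaps `Q_{2j+1} - Q_{2j+2}`.
-- Monotonicity gives `0 ≤ R ≤ Q_0`, so `Q_0 - 2R` lies between `-Q_0` and `Q_0`. No commutativity
-- of the `Q_k` is needed.
lemma norm_alternating_sum_le {Q : ℕ → A} (hQ : ∀ k, 0 ≤ Q k) (hQ1 : ‖Q 0‖ ≤ 1)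
    (hanti : ∀ k, Q (k + 1) ≤ Q k) {ρ : ℝ} (hρ : 0 ≤ ρ) (N : ℕ) :
    ‖∑ j ∈ range (N + 1), ((if j = 0 then ρ else 2 * ρ : ℝ) : ℂ) • Q (2 * j) -
      ∑ j ∈ range N, ((2 * ρ : ℝ) : ℂ) • Q (2 * j + 1)‖ ≤ ρ := by
  set R := ∑ j ∈ range N, (Q (2 * j + 1) - Q (2 * j + 2)) with hR
  have hR0 : 0 ≤ R := sum_nonneg fun j _ => sub_nonneg.2 (hanti (2 * j + 1))
  have hR1 : R ≤ Q 0 - Q (2 * N) := by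
    rw [hR]
    clear hR0 hR
    clear R
    induction N with
    | zero => simp
    | succ N ih =>
      rw [sum_range_succ]
      have h2 := sub_nonneg.2 (hanti (2 * N))
      calc _ ≤ Q 0 - Q (2 * N) + (Q (2 * N + 1) - Q (2 * N + 2)) := by gcongr
        _ = Q 0 - Q (2 * (N + 1)) - (Q (2 * N) - Q (2 * N + 1)) := by
          rw [show 2 * (N + 1) = 2 * N + 2 by ring]; abel
        _ ≤ _ := sub_le_self _ h2
  have hRQ : R ≤ Q 0 := hR1.trans (sub_le_self _ (hQ _))
  have hd : ‖Q 0 - (R + R)‖ ≤ 1 := by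
    refine norm_le_one_of_neg_le_of_le (hQ 0) hQ1 ?_ ?_
    · rw [le_sub_iff_add_le, neg_add_le_iff_le_add]
      exact add_le_add hRQ hRQ
    · exact sub_le_self _ (add_nonneg hR0 hR0)
  have : ∑ j ∈ range (N + 1), ((if j = 0 then ρ else 2 * ρ : ℝ) : ℂ) • Q (2 * j) -
      ∑ j ∈ range N, ((2 * ρ : ℝ) : ℂ) • Q (2 * j + 1) = (ρ : ℂ) • (Q 0 - (R + R)) := by
    rw [sum_range_succ', if_pos rfl, hR, smul_sub, ← two_smul ℂ, smul_smul, smul_sum]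
    have h1 : ∀ j : ℕ, ((if j + 1 = 0 then ρ else 2 * ρ : ℝ) : ℂ) • Q (2 * (j + 1)) =
        ((2 * ρ : ℝ) : ℂ) • Q (2 * j + 2) := fun j => by
      rw [if_neg (by omega), show 2 * (j + 1) = 2 * j + 2 by ring]
    have h2 : ((2 * ρ : ℝ) : ℂ) = (ρ : ℂ) * 2 := by push_cast; ring
    simp only [h1, h2, smul_sub, sum_sub_distrib, mul_zero]
    abel
  rw [this, norm_smul, Complex.norm_real, Real.norm_of_nonneg hρ]
  exact mul_le_of_le_one_right hρ hd

end OrderBound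

/-! ### The upper bound for `d_U` -/

section UpperBound

variable {A : Type u} [NonUnitalCStarAlgebra A]

/-- An interlacing sequence: `v k` carries the `k`-th level of `φ` (`k` even) or of `ψ` (`k` odd)
onto a decreasing sequence of subalgebras. -/
theorem exists_interlacing_sequence (φ ψ : C01 →⋆ₙₐ[ℂ] A) {r : ℝ≥0}
    (h : ∀ t : ℝ≥0, CuntzLE (φ (C01.e (t + r))) (ψ (C01.e t)) ∧
      CuntzLE (ψ (C01.e (t + r))) (φ (C01.e t)))
    {δ ρ : ℝ} (hδ : 0 < δ) (hρ : 0 < ρ) (hρr : ρ = r + 3 * δ) :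
    ∃ v : ℕ → A,
      (∀ k, star (v k) * v k = (if Even k then φ else ψ) (C01.level hδ hρ k)) ∧
      (∀ k, ∃ z : A, ‖z‖ ≤ 1 ∧ v (k + 1) = v k * z) ∧
      (∀ k, v k * star (v k) * v (k + 1) = v (k + 1)) := by
  let c : ℕ → C01 →⋆ₙₐ[ℂ] A := fun k => if Even k then φ else ψ
  have hc : ∀ (k : ℕ) (t : ℝ≥0), CuntzLE (c (k + 1) (C01.e (t + r))) (c k (C01.e t)) := by
    intro k t
    by_cases hk : Even k
    · simp only [c, hk, if_true, Nat.even_add_one, not_true, if_false]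
      exact (h t).2
    · simp only [c, hk, if_false, Nat.even_add_one, not_false_iff, if_true]
      exact (h t).1
  have hz : ∀ k : ℕ, ∃ z : A, star z * z = c (k + 1) (C01.level hδ hρ (k + 1)) ∧
      c k (C01.level hδ hρ k) * z = z := by
    intro k
    -- Level `k` is `1` from `s = kρ + 2δ` on. Level `k + 1` vanishes up to `(k + 1)ρ + δ`, which is
    -- `s + r + 2δ` because `ρ = r + 3δ`; this is the margin that the factorization requires.
    let s : ℝ≥0 := ⟨k * ρ + 2 * δ, by positivity⟩
    have hs : (s : ℝ) = k * ρ + 2 * δ := rfl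
    refine exists_star_mul_self_eq_of_cuntzLE (c (k + 1)) (c k) (s := s) (t := s + r) (hc k s) hδ
      (continuous_levelFun _ _ _) (fun x => ramp_nonneg _ _) (fun x hx => ?_) _
      (continuous_levelFun _ _ _) _ (fun x hx => ?_)
    · refine ramp_eq_zero hδ ?_
      push_cast at hx ⊢
      rw [hs] at hx
      linarith
    · exact ramp_eq_one hδ (by rw [hs] at hx; linarith)
  choose z hz1 hz2 using hz
  have hnorm : ∀ k, ‖c k (C01.level hδ hρ k)‖ ≤ 1 := fun k =>
    (NonUnitalStarAlgHom.norm_apply_le _ _).trans (C01.norm_level_le hδ hρ k)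
  let v0 : A := φ (C01.ofReal (fun x => √(levelFun δ ρ 0 x))
    (continuous_levelFun δ ρ 0).sqrt (by rw [levelFun_zero hδ hρ, Real.sqrt_zero]))
  have hv0 : star v0 = v0 := (C01.isSelfAdjoint_ofReal _ _ _).map φ
  have hv00 : v0 * v0 = φ (C01.level hδ hρ 0) := by
    simp only [v0]
    rw [← map_mul]
    congr 1
    exact C01.ofReal_mul_ofReal _ _ _ _ _ _ fun x _ _ => Real.mul_self_sqrt (ramp_nonneg _ _)
  -- `v_k` is the product of `v0` and the successive factors `z_0, …, z_{k-1}`. Since the `k`-th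
  -- level is a left unit for `z_k`, `v_{k+1}* v_{k+1}` collapses to `z_k* z_k`.
  let v : ℕ → A := fun k => Nat.rec v0 (fun k x => x * z k) k
  have hvs : ∀ k, v (k + 1) = v k * z k := fun _ => rfl
  have hv : ∀ k, star (v k) * v k = c k (C01.level hδ hρ k) := by
    intro k
    induction k with
    | zero =>
      change star v0 * v0 = _
      rw [hv0, hv00]
      simp [c]
    | succ k ih =>
      rw [hvs, star_mul, ← hz1 k]
      calc _ = star (z k) * (star (v k) * v k * z k) := by simp only [mul_assoc]
        _ = _ := by rw [ih, hz2]
  refine ⟨v, hv, fun k => ⟨z k, ?_, hvs k⟩, fun k => ?_⟩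
  · have h1 := hnorm (k + 1)
    rw [← hz1, CStarRing.norm_star_mul_self] at h1
    nlinarith [norm_nonneg (z k)]
  · rw [hvs]
    calc _ = v k * (star (v k) * v k * z k) := by simp only [mul_assoc]
      _ = _ := by rw [hv, hz2]

lemma dU_le_of_approxUnitEquiv {a b a₁ a₂ b₁ b₂ : A} (ha : StablyApproxUnitEquiv a₁ a₂)
    (hb : StablyApproxUnitEquiv b₁ b₂) {C₁ C₂ C₃ : ℝ} (h₁ : ‖a - a₁‖ ≤ C₁) (h₂ : ‖a₂ - b₂‖ ≤ C₂)
    (h₃ : ‖b - b₁‖ ≤ C₃) : dU a b ≤ C₁ + C₂ + C₃ := by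
  rw [stablyApproxUnitEquiv_iff] at ha hb
  refine le_of_forall_pos_le_add fun ε hε => ?_
  obtain ⟨u, hu⟩ := ha (ε / 2) (by positivity)
  obtain ⟨v, hv⟩ := hb (ε / 2) (by positivity)
  refine (ciInf_le ⟨0, ?_⟩ (star u, star v)).trans ?_
  · rintro _ ⟨p, rfl⟩
    exact norm_nonneg _
  · simp only [Unitary.coe_star, star_star]
    have hι : ∀ x y : A, inStabUnit (x - y) = inStabUnit x - inStabUnit y :=
      fun x y => map_sub inStabUnitHom x y
    have e : star (u : StabUnit A) * inStabUnit a * u - star (v : StabUnit A) * inStabUnit b * v =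
        star (u : StabUnit A) * inStabUnit (a - a₁) * u +
        (star (u : StabUnit A) * inStabUnit a₁ * u - inStabUnit a₂) +
        inStabUnit (a₂ - b₂) +
        -((star (v : StabUnit A) * inStabUnit b₁ * v - inStabUnit b₂)) +
        -(star (v : StabUnit A) * inStabUnit (b - b₁) * v) := by
      rw [hι, hι, hι]
      noncomm_ring
    rw [e]
    refine (norm_add_le _ _).trans ?_
    refine (add_le_add_left (norm_add_le _ _) _).trans ?_
    refine (add_le_add_left (add_le_add_left (norm_add₃_le) _) _).trans ?_
    rw [norm_neg, norm_neg, norm_star_coe_unitary_mul_mul, norm_star_coe_unitary_mul_mul,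
      norm_inStabUnit, norm_inStabUnit, norm_inStabUnit]
    linarith

variable [PartialOrder A] [StarOrderedRing A]

theorem PropertyI.dU_le (hI : PropertyI A) (φ ψ : C01 →⋆ₙₐ[ℂ] A) {r : ℝ≥0}
    (h : ∀ t : ℝ≥0, CuntzLE (φ (C01.e (t + r))) (ψ (C01.e t)) ∧
      CuntzLE (ψ (C01.e (t + r))) (φ (C01.e t))) :
    dU (φ C01.ident) (ψ C01.ident) ≤ 3 * r := by
  refine le_of_forall_pos_le_add fun ε hε => ?_
  -- The final error is `(ρ + 2δ) + ρ + (ρ + 2δ) = 3r + 13δ`.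
  set δ : ℝ := ε / 13 with hδdef
  have hδ : 0 < δ := by positivity
  set ρ : ℝ := r + 3 * δ with hρr
  have hr0 : (0 : ℝ) ≤ r := r.2
  have hρ : 0 < ρ := by positivity
  have hδρ : δ ≤ ρ := by linarith
  obtain ⟨v, hv, hvz, hvv⟩ := exists_interlacing_sequence φ ψ h hδ hρ hρr
  have hnorm : ∀ k, ‖v k‖ ≤ 1 := by
    intro k
    have h1 : ‖star (v k) * v k‖ ≤ 1 := by
      rw [hv]
      exact (NonUnitalStarAlgHom.norm_apply_le _ _).trans (C01.norm_level_le hδ hρ k)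
    rw [CStarRing.norm_star_mul_self] at h1
    nlinarith [norm_nonneg (v k)]
  -- Indices of equal parity belong to the same homomorphism, where the lower level is `1` on the
  -- support of the higher one. This is why the even and the odd `v_k` are treated as two separate
  -- chains.
  have hright : ∀ k, v (k + 2) * (star (v k) * v k) = v (k + 2) := by
    intro k
    have hpar : (if Even (k + 2) then φ else ψ) = if Even k then φ else ψ := by simp [Nat.even_add]
    refine mul_eq_self_of_star_mul_self_mul_eq (IsSelfAdjoint.star_mul_self _) rfl ?_
    rw [hv, hv, hpar, ← map_mul, mul_comm, C01.level_mul_level hδ hδρ hρ (by omega)]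
  have hleft : ∀ k, v k * star (v k) * v (k + 2) = v (k + 2) := by
    intro k
    obtain ⟨z, -, hz⟩ := hvz (k + 1)
    rw [show k + 2 = k + 1 + 1 from rfl, hz, ← mul_assoc, hvv]
  obtain ⟨N, hN⟩ := exists_nat_gt (1 / ρ)
  have hN' : 1 ≤ (2 * ((N + 1 : ℕ) : ℝ) + 1) * ρ := by
    rw [div_lt_iff₀ hρ] at hN
    push_cast
    nlinarith
  let w : ℕ → ℝ := fun j => if j = 0 then ρ else 2 * ρ
  have hw : ∀ j, 0 < w j := fun j => by simp only [w]; split_ifs <;> positivity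
  -- The even chain has one term more than the odd one, its initial weight being `ρ` instead of
  -- `2ρ`. This matches the alternating sum.
  have heven := hI.stablyApproxUnitEquiv_sum hw (N + 1) (fun j => v (2 * j)) (fun _ _ => hnorm _)
    (fun j _ => hright (2 * j)) (fun j _ => hleft (2 * j))
  have hodd := hI.stablyApproxUnitEquiv_sum (w := fun _ => 2 * ρ) (fun _ => by positivity) N
    (fun j => v (2 * j + 1)) (fun _ _ => hnorm _)
    (fun j _ => hright (2 * j + 1)) (fun j _ => hleft (2 * j + 1))
  have hve : ∀ j, star (v (2 * j)) * v (2 * j) = φ (C01.level hδ hρ (2 * j)) := fun j => by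
    rw [hv, if_pos (even_two_mul j)]
  have hvo : ∀ j, star (v (2 * j + 1)) * v (2 * j + 1) = ψ (C01.level hδ hρ (2 * j + 1)) :=
    fun j => by rw [hv, if_neg (by simp)]
  simp only [hve] at heven
  simp only [hvo] at hodd
  have hA := C01.norm_ident_sub_sum_even_level_le hδ hδρ hρ (N + 1) hN'
  have hB := C01.norm_ident_sub_sum_odd_level_le hδ hδρ hρ (N + 1) hN'
  have hA' := (NonUnitalStarAlgHom.norm_apply_le φ _).trans hA
  have hB' := (NonUnitalStarAlgHom.norm_apply_le ψ _).trans hB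
  rw [map_sub, map_sum] at hA' hB'
  simp only [map_smul] at hA' hB'
  have hQ : ∀ k, v (k + 1) * star (v (k + 1)) ≤ v k * star (v k) := by
    intro k
    obtain ⟨z, hz1, hz⟩ := hvz k
    have hzz : ‖z * star z‖ ≤ 1 := by
      rw [CStarRing.norm_self_mul_star]; nlinarith [norm_nonneg z]
    have h1 := CStarAlgebra.star_right_conjugate_le_norm_smul (a := v k) (b := z * star z)
      (IsSelfAdjoint.mul_star_self z)
    rw [hz, star_mul]
    calc _ = v k * (z * star z) * star (v k) := by simp only [mul_assoc]
      _ ≤ ‖z * star z‖ • (v k * star (v k)) := h1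
      _ ≤ (1 : ℝ) • (v k * star (v k)) :=
          smul_le_smul_of_nonneg_right hzz (mul_star_self_nonneg _)
      _ = _ := one_smul _ _
  have hQ0 : ‖v 0 * star (v 0)‖ ≤ 1 := by
    rw [CStarRing.norm_self_mul_star]; nlinarith [norm_nonneg (v 0), hnorm 0]
  have hmid := norm_alternating_sum_le (Q := fun k => v k * star (v k))
    (fun k => mul_star_self_nonneg _) hQ0 hQ hρ.le (N + 1)
  refine (dU_le_of_approxUnitEquiv heven hodd hA' hmid hB').trans ?_
  rw [hρr, hδdef]
  linarith

theorem PropertyI.dU_le_dW (hI : PropertyI A) (φ ψ : C01 →⋆ₙₐ[ℂ] A) :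
    dU (φ C01.ident) (ψ C01.ident) ≤ 3 * dW (Cu.map φ) (Cu.map ψ) := by
  set S := {r : ℝ≥0 | ∀ t : ℝ≥0, Cu.map φ (C01.cuE (t + r)) ≤ Cu.map ψ (C01.cuE t) ∧
    Cu.map ψ (C01.cuE (t + r)) ≤ Cu.map φ (C01.cuE t)} with hS
  -- `r = 1` is always admissible because `e_{t+1} = 0`. This matters because the infimum of the
  -- empty set in `ℝ≥0` is `0`.
  have hne : S.Nonempty := by
    refine ⟨1, fun t => ?_⟩
    have he : C01.e (t + 1) = 0 := by
      ext x
      have : max ((x : ℝ) - (t + 1 : ℝ≥0)) 0 = 0 := by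
        refine max_eq_right ?_
        have := x.2.2
        have ht : (0 : ℝ) ≤ t := t.2
        push_cast
        linarith
      simp [C01.e, C01.ofReal_apply] at this ⊢
      exact this
    have h0 : ∀ b : A, CuntzLE 0 b := fun b => ⟨fun _ => 0, by simp⟩
    rw [Cu.map_cuE_le_iff, Cu.map_cuE_le_iff, he, map_zero, map_zero]
    exact ⟨h0 _, h0 _⟩
  refine le_of_forall_pos_le_add fun ε hε => ?_
  obtain ⟨r, hr, hlt⟩ := exists_lt_of_csInf_lt hne
    (lt_add_of_pos_right (sInf S) (show (0 : ℝ≥0) < ⟨ε / 3, by positivity⟩ from by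
      change (0 : ℝ) < ε / 3; positivity))
  have h1 := hI.dU_le φ ψ (r := r) fun t => by
    have := hr t
    rwa [Cu.map_cuE_le_iff, Cu.map_cuE_le_iff] at this
  have h2 : (r : ℝ) < dW (Cu.map φ) (Cu.map ψ) + ε / 3 := NNReal.coe_lt_coe.2 hlt
  linarith

end UpperBound

/-! ### Homomorphisms from `C₀(0,1]` and functional calculus -/

section FunctionalCalculus

lemma continuous_starHom {A : Type u} [NonUnitalCStarAlgebra A] {B : Type v}
    [NonUnitalCStarAlgebra B] (φ : A →⋆ₙₐ[ℂ] B) : Continuous φ :=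
  AddMonoidHomClass.continuous_of_bound φ 1
    fun x => by simpa using NonUnitalStarAlgHom.norm_apply_le φ x

/-- The extension of `f ∈ C₀(0,1]` to `ℝ` that is `0` on `(-∞, 0]` and constant on `[1, ∞)`. -/
def C01.extend (f : C01) (x : ℝ) : ℂ :=
  if hx : 0 < x then f ⟨min x 1, lt_min hx one_pos, min_le_right _ _⟩ else 0

lemma C01.extend_of_mem (f : C01) (x : Set.Ioc (0 : ℝ) 1) : f.extend x = f x := by
  rw [C01.extend, dif_pos x.2.1]
  congr
  exact min_eq_left x.2.2

lemma C01.extend_of_nonpos (f : C01) {x : ℝ} (hx : x ≤ 0) : f.extend x = 0 := dif_neg hx.not_gt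

lemma C01.extend_add (f g : C01) (x : ℝ) : (f + g).extend x = f.extend x + g.extend x := by
  unfold C01.extend; split_ifs <;> simp

lemma C01.extend_mul (f g : C01) (x : ℝ) : (f * g).extend x = f.extend x * g.extend x := by
  unfold C01.extend; split_ifs <;> simp

lemma C01.extend_smul (c : ℂ) (f : C01) (x : ℝ) : (c • f).extend x = c • f.extend x := by
  unfold C01.extend; split_ifs <;> simp

lemma C01.extend_star (f : C01) (x : ℝ) : (star f).extend x = star (f.extend x) := by
  unfold C01.extend; split_ifs <;> simp

lemma C01.extend_zero_apply (x : ℝ) : (0 : C01).extend x = 0 := by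
  unfold C01.extend; split_ifs <;> simp

lemma C01.tendsto_extend_zero (f : C01) : Tendsto f.extend (𝓝 0) (𝓝 0) := by
  rw [Metric.tendsto_nhds]
  intro ε hε
  have h := (Metric.tendsto_nhds.1 (zero_at_infty f)) ε hε
  rw [Filter.Eventually, Filter.mem_cocompact] at h
  obtain ⟨K, hK, hKs⟩ := h
  have hK' : IsCompact (Subtype.val '' K : Set ℝ) := hK.image continuous_subtype_val
  have h0 : (0 : ℝ) ∉ (Subtype.val '' K : Set ℝ) := by
    rintro ⟨x, _, hx⟩
    exact x.2.1.ne' hx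
  have h1 : ∀ᶠ x : ℝ in 𝓝 0, x ∉ (Subtype.val '' K : Set ℝ) :=
    hK'.isClosed.isOpen_compl.mem_nhds h0
  have h2 : ∀ᶠ x : ℝ in 𝓝 0, x < 1 := Iio_mem_nhds one_pos
  filter_upwards [h1, h2] with x hx1 hx2
  rcases le_or_gt x 0 with hx | hx
  · rw [C01.extend_of_nonpos f hx, dist_self]; exact hε
  · have := C01.extend_of_mem f ⟨x, hx, hx2.le⟩
    simp only at this
    rw [this]
    exact hKs (show (⟨x, hx, hx2.le⟩ : Set.Ioc (0 : ℝ) 1) ∈ Kᶜ from fun hmem => hx1 ⟨_, hmem, rfl⟩)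

lemma C01.continuous_extend (f : C01) : Continuous f.extend := by
  rw [continuous_iff_continuousAt]
  intro x
  rcases lt_trichotomy x 0 with hx | rfl | hx
  · refine (continuousAt_const (y := (0 : ℂ))).congr ?_
    filter_upwards [Iio_mem_nhds hx] with y hy
    exact (C01.extend_of_nonpos f (le_of_lt hy)).symm
  · rw [ContinuousAt, C01.extend_of_nonpos f le_rfl]
    exact f.tendsto_extend_zero
  · have hon : ContinuousOn f.extend (Set.Ioi 0) := by
      rw [continuousOn_iff_continuous_domRestrict]
      have : (Set.Ioi (0 : ℝ)).domRestrict f.extend = fun y : Set.Ioi (0 : ℝ) =>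
          f ⟨min y 1, lt_min y.2 one_pos, min_le_right _ _⟩ := by
        ext y
        exact dif_pos (show (0 : ℝ) < y from y.2)
      rw [this]
      exact f.continuous.comp (by fun_prop)
    exact hon.continuousAt (Ioi_mem_nhds hx)

/-- The extension of `f ∈ C₀(0,1]` to `ℂ` through the real part. -/
def C01.cext (f : C01) (z : ℂ) : ℂ := f.extend z.re

lemma C01.continuous_cext (f : C01) : Continuous f.cext :=
  f.continuous_extend.comp Complex.continuous_re

lemma C01.cext_zero (f : C01) : f.cext 0 = 0 := C01.extend_of_nonpos f (by simp)

/-- Evaluation at a point of `(0,1]`. -/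
def C01.eval (x : Set.Ioc (0 : ℝ) 1) : C01 →⋆ₙₐ[ℂ] ℂ where
  toFun f := f x
  map_smul' _ _ := rfl
  map_zero' := rfl
  map_add' _ _ := rfl
  map_mul' _ _ := rfl
  map_star' _ := rfl

lemma C01.cfcₙ_cext_ident (f : C01) : cfcₙ f.cext C01.ident = f := by
  ext x
  have h := (C01.eval x).map_cfcₙ f.cext C01.ident (f.continuous_cext.continuousOn) f.cext_zero
    (continuous_starHom _) (C01.isSelfAdjoint_ofReal _ _ _).isStarNormal
    ((C01.isSelfAdjoint_ofReal _ _ _).map (C01.eval x)).isStarNormal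
  change cfcₙ f.cext C01.ident x = _
  have h2 : cfcₙ f.cext (C01.eval x C01.ident) = f x := by
    have : C01.eval x C01.ident = algebraMap ℂ ℂ ((x : ℝ) : ℂ) := rfl
    rw [this, cfcₙ_eq_cfc (f.continuous_cext.continuousOn) f.cext_zero, cfc_algebraMap]
    simp [C01.cext, C01.extend_of_mem]
  exact h.trans h2

lemma C01.cfcₙ_ident {g : ℝ → ℝ} (hg : Continuous g) (g0 : g 0 = 0) :
    cfcₙ g C01.ident = C01.ofReal g hg g0 := by
  ext x
  have h := (C01.eval x).map_cfcₙ g C01.ident hg.continuousOn g0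
    (continuous_starHom _) (C01.isSelfAdjoint_ofReal _ _ _)
    ((C01.isSelfAdjoint_ofReal _ _ _).map _)
  change cfcₙ g C01.ident x = _
  have h2 : cfcₙ g (C01.eval x C01.ident) = (g x : ℂ) := by
    have : C01.eval x C01.ident = algebraMap ℝ ℂ (x : ℝ) := rfl
    rw [this, cfcₙ_eq_cfc hg.continuousOn g0, cfc_algebraMap]
    rfl
  exact h.trans h2

variable {A : Type u} [NonUnitalCStarAlgebra A]

lemma map_eq_cfcₙ_cext (φ : C01 →⋆ₙₐ[ℂ] A) (f : C01) : φ f = cfcₙ f.cext (φ C01.ident) := by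
  conv_lhs => rw [← f.cfcₙ_cext_ident]
  exact φ.map_cfcₙ f.cext C01.ident (f.continuous_cext.continuousOn) f.cext_zero
    (continuous_starHom _) (C01.isSelfAdjoint_ofReal _ _ _).isStarNormal
    ((C01.isSelfAdjoint_ofReal _ _ _).map φ).isStarNormal

lemma map_ofReal_eq_cfcₙ (φ : C01 →⋆ₙₐ[ℂ] A) {g : ℝ → ℝ} (hg : Continuous g) (g0 : g 0 = 0) :
    φ (C01.ofReal g hg g0) = cfcₙ g (φ C01.ident) := by
  rw [← C01.cfcₙ_ident hg g0]
  exact φ.map_cfcₙ g C01.ident hg.continuousOn g0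
    (continuous_starHom _) (C01.isSelfAdjoint_ofReal _ _ _)
    ((C01.isSelfAdjoint_ofReal _ _ _).map φ)

lemma norm_le_of_mem_quasispectrum {a : A} {z : ℂ} (hz : z ∈ quasispectrum ℂ a) : ‖z‖ ≤ ‖a‖ := by
  rw [Unitization.quasispectrum_eq_spectrum_inr ℂ a] at hz
  exact (spectrum.norm_le_norm_of_mem hz).trans_eq (Unitization.norm_inr a)

/-- The value at `f` is a fixed continuous function of the value at `id`. The quasispectra all lie
in one compact ball, on which the functional calculus is continuous in the element. -/
lemma tendsto_map_of_tendsto_map_ident {Θ : ℕ → C01 →⋆ₙₐ[ℂ] A} {θ : C01 →⋆ₙₐ[ℂ] A}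
    (h : Tendsto (fun n => Θ n C01.ident) atTop (𝓝 (θ C01.ident))) (f : C01) :
    Tendsto (fun n => Θ n f) atTop (𝓝 (θ f)) := by
  simp only [map_eq_cfcₙ_cext _ f]
  have hq : ∀ φ : C01 →⋆ₙₐ[ℂ] A,
      quasispectrum ℂ (φ C01.ident) ⊆ Metric.closedBall 0 ‖C01.ident‖ := fun φ z hz => by
    rw [mem_closedBall_zero_iff]
    exact (norm_le_of_mem_quasispectrum hz).trans (NonUnitalStarAlgHom.norm_apply_le φ _)
  have hn : ∀ φ : C01 →⋆ₙₐ[ℂ] A, IsStarNormal (φ C01.ident) := fun φ =>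
    ((C01.isSelfAdjoint_ofReal _ _ _).map φ).isStarNormal
  exact h.cfcₙ (isCompact_closedBall (0 : ℂ) ‖C01.ident‖) f.cext
    (Eventually.of_forall fun n => hq _) (Eventually.of_forall fun n => hn _) (hq _) (hn _)
    f.continuous_cext.continuousOn f.cext_zero

/-- The *-homomorphism `C₀(0,1] → A` given by the functional calculus of `a`. It maps `id` to `a` if
`a` is a positive contraction. -/
def homOfElement (a : A) : C01 →⋆ₙₐ[ℂ] A where
  toFun f := cfcₙ f.cext a
  map_smul' c f := by
    rw [MonoidHom.id_apply, ← cfcₙ_smul c f.cext a f.continuous_cext.continuousOn f.cext_zero]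
    exact cfcₙ_congr fun z _ => C01.extend_smul c f z.re
  map_zero' := by
    rw [← cfcₙ_zero ℂ a]
    exact cfcₙ_congr fun z _ => C01.extend_zero_apply z.re
  map_add' f g := by
    rw [← cfcₙ_add f.cext g.cext a f.continuous_cext.continuousOn f.cext_zero
      g.continuous_cext.continuousOn g.cext_zero]
    exact cfcₙ_congr fun z _ => C01.extend_add f g z.re
  map_mul' f g := by
    rw [← cfcₙ_mul f.cext g.cext a f.continuous_cext.continuousOn f.cext_zero
      g.continuous_cext.continuousOn g.cext_zero]
    exact cfcₙ_congr fun z _ => C01.extend_mul f g z.re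
  map_star' f := by
    rw [← cfcₙ_star f.cext a]
    exact cfcₙ_congr fun z _ => C01.extend_star f z.re

lemma homOfElement_ident [PartialOrder A] [StarOrderedRing A] {a : A} (ha : 0 ≤ a) (ha1 : ‖a‖ ≤ 1) :
    homOfElement a C01.ident = a := by
  change cfcₙ (C01.ident).cext a = a
  conv_rhs => rw [← cfcₙ_id' ℝ a ha.isSelfAdjoint, cfcₙ_real_eq_complex _ ha.isSelfAdjoint]
  refine cfcₙ_congr fun z hz => ?_
  have h1 : ‖z‖ ≤ 1 := (norm_le_of_mem_quasispectrum hz).trans ha1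
  have h2 : z.re ≤ 1 := (Complex.re_le_norm z).trans h1
  have h3 : 0 ≤ z.re := by
    exact quasispectrum_nonneg_of_nonneg a ha _
      (ha.isSelfAdjoint.quasispectrumRestricts.apply_mem hz)
  rcases h3.lt_or_eq with h3 | h3
  · exact C01.extend_of_mem C01.ident ⟨z.re, h3, h2⟩
  · simp only [C01.cext, ← h3]
    simp [C01.extend_of_nonpos]

end FunctionalCalculus

/-! ### Property (I) implies property (II) -/

section Converse

variable {A : Type u} [NonUnitalCStarAlgebra A]

lemma stablyApproxUnitEquivHom_of_dU_nonpos {φ ψ : C01 →⋆ₙₐ[ℂ] A} (h : dU (φ C01.ident) (ψ C01.ident) ≤ 0) :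
    StablyApproxUnitEquivHom φ ψ := by
  have key : ApproxUnitEquiv (inStabUnit (φ C01.ident)) (inStabUnit (ψ C01.ident)) := by
    intro ε hε
    obtain ⟨⟨p, q⟩, hpq⟩ := exists_lt_of_ciInf_lt (h.trans_lt hε)
    refine ⟨star p * q, ?_⟩
    simp only at hpq
    rw [← norm_star_coe_unitary_mul_mul q] at hpq
    refine lt_of_eq_of_lt (congrArg norm ?_) hpq
    have h1 : star (q : StabUnit A) * (q : StabUnit A) = 1 := Unitary.coe_star_mul_self q
    have h2 : star (q : StabUnit A) * (q * inStabUnit (ψ C01.ident) * star (q : StabUnit A)) * q =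
        inStabUnit (ψ C01.ident) := by
      calc _ = (star (q : StabUnit A) * q) * inStabUnit (ψ C01.ident) *
            (star (q : StabUnit A) * q) := by simp only [mul_assoc]
        _ = _ := by rw [h1, one_mul, mul_one]
    rw [mul_sub, sub_mul, h2, Submonoid.coe_mul, Unitary.coe_star, star_mul, star_star]
    simp only [mul_assoc]
  choose u hu using fun n : ℕ => key (1 / ((n : ℝ) + 1)) (by positivity)
  refine ⟨fun n => star (u n), fun f => ?_⟩
  let Θ : ℕ → C01 →⋆ₙₐ[ℂ] StabUnit A := fun n =>
    ((Unitary.conjStarAlgAut ℂ (StabUnit A) (star (u n)) : StabUnit A →⋆ₙₐ[ℂ] StabUnit A)).comp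
      (inStabUnitHom.comp φ)
  refine tendsto_map_of_tendsto_map_ident (Θ := Θ) (θ := inStabUnitHom.comp ψ) ?_ f
  refine tendsto_iff_norm_sub_tendsto_zero.2 (squeeze_zero (fun _ => norm_nonneg _)
    (fun n => ?_) tendsto_one_div_add_atTop_nhds_zero_nat)
  refine (congrArg norm (congrArg (· - _) ?_)).trans_le (hu n).le
  change ((star (u n) : unitary (StabUnit A)) : StabUnit A) * inStabUnit (φ C01.ident) *
    ((star (star (u n)) : unitary (StabUnit A)) : StabUnit A) = _
  rw [star_star]
  rfl

theorem PropertyI.propertyII [PartialOrder A] [StarOrderedRing A] (hI : PropertyI A) :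
    PropertyII A := fun φ ψ h =>
  stablyApproxUnitEquivHom_of_dU_nonpos ((hI.dU_le_dW φ ψ).trans_eq (by rw [h, mul_zero]))

end Converse

/-! ### Further Cuntz comparisons -/

section CuntzLemmas

variable {A : Type u} [NonUnitalCStarAlgebra A]

lemma CuntzLE.of_forall_norm_sub_le {a b : A}
    (h : ∀ ε > 0, ∃ a' : A, CuntzLE a' b ∧ ‖a' - a‖ ≤ ε) : CuntzLE a b := by
  rw [cuntzLE_iff]
  intro ε hε
  obtain ⟨a', ha', hn⟩ := h (ε / 2) (by positivity)
  obtain ⟨d, hd⟩ := cuntzLE_iff.1 ha' (ε / 2) (by positivity)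
  refine ⟨d, ?_⟩
  have : star d * b * d - a = (star d * b * d - a') + (a' - a) := by abel
  rw [this]
  linarith [norm_add_le (star d * b * d - a') (a' - a)]

/-- Polar decomposition applied to `√a` and `(C b)^(1/2)`. The approximants lie in `A` after the
factor `k_n √a` is absorbed into the ideal. -/
lemma CuntzLE.of_le_smul [PartialOrder A] [StarOrderedRing A] {a b : A} (ha : 0 ≤ a) (hb : 0 ≤ b)
    {C : ℝ} (hC : 0 ≤ C) (h : a ≤ C • b) : CuntzLE a b := by
  set s := CFC.sqrt a
  set r := CFC.sqrt b
  have hs : IsSelfAdjoint s := (CFC.sqrt_nonneg _).isSelfAdjoint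
  have hr : IsSelfAdjoint r := (CFC.sqrt_nonneg _).isSelfAdjoint
  have hss : s * s = a := CFC.sqrt_mul_sqrt_self a ha
  have hrr : r * r = b := CFC.sqrt_mul_sqrt_self b hb
  have hCC : √C * √C = C := Real.mul_self_sqrt hC
  have hle : (s : Unitization ℂ A) * s ≤
      star ((√C • r : A) : Unitization ℂ A) * ((√C • r : A) : Unitization ℂ A) := by
    rw [← Unitization.inr_mul, ← Unitization.inr_star, ← Unitization.inr_mul, star_smul, hr.star_eq,
      smul_mul_smul_comm, star_trivial, hCC, hss, hrr]
    refine (Unitization.inr_le_iff _ _ ha.isSelfAdjoint ?_).2 h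
    exact (smul_nonneg hC hb).isSelfAdjoint
  obtain ⟨k, d, hk, hd⟩ := exists_tendsto_star_mul_self_eq (hs.inr _) hle
  choose c hc using fun n => exists_inr_mul_inr (k n) s
  refine ⟨fun n => √C • c n, ?_⟩
  have hiso := (Unitization.isometry_inr (𝕜 := ℂ) (A := A)).isEmbedding
  rw [hiso.tendsto_nhds_iff]
  have hlim := hk.star.mul hk
  rw [hd, ← Unitization.inr_mul, hss] at hlim
  refine hlim.congr fun n => ?_
  change _ = ((star (√C • c n) * b * (√C • c n) : A) : Unitization ℂ A)
  rw [mul_assoc _ (k n), hc n, ← Unitization.inr_mul, ← Unitization.inr_star, ← Unitization.inr_mul]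
  congr 1
  rw [← hrr]
  simp only [star_mul, star_smul, hr.star_eq, star_trivial, smul_mul_assoc, mul_smul_comm, mul_assoc]

/-- Unitary closeness within `ε` compares `φ(e_{t+ε})` with `ψ(e_t)`, and `e_{t+ε}` is within `ε` of
`e_t`. -/
lemma CuntzLE.of_stablyApproxUnitEquiv {φ ψ : C01 →⋆ₙₐ[ℂ] A}
    (h : StablyApproxUnitEquiv (ψ C01.ident) (φ C01.ident)) (t : ℝ≥0) :
    CuntzLE (φ (C01.e t)) (ψ (C01.e t)) := by
  refine CuntzLE.of_forall_norm_sub_le fun ε hε => ?_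
  let r : ℝ≥0 := ⟨ε, hε.le⟩
  obtain ⟨u, hu⟩ := (stablyApproxUnitEquiv_iff.1 h) ε hε
  refine ⟨φ (C01.e (t + r)), cuntzLE_e_of_norm_lt φ ψ (star u) ?_, ?_⟩
  · rw [Unitary.coe_star, star_star]; exact hu
  · rw [← map_sub]
    refine (NonUnitalStarAlgHom.norm_apply_le φ _).trans ?_
    have : C01.e (t + r) - C01.e t =
        C01.ofReal (fun x => max (x - (t + r : ℝ≥0)) 0 - max (x - t) 0) (by fun_prop) (by
          rw [zero_sub, zero_sub, max_eq_right (neg_nonpos.2 (NNReal.coe_nonneg _)),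
            max_eq_right (neg_nonpos.2 (NNReal.coe_nonneg _)), sub_zero]) := by
      ext x
      simp [C01.e, C01.ofReal_apply]
    rw [this]
    refine C01.norm_ofReal_le _ _ hε.le fun x _ _ => ?_
    have hr : ((t + r : ℝ≥0) : ℝ) = t + ε := rfl
    rw [hr]
    refine (abs_max_sub_max_le_abs _ _ _).trans ?_
    rw [show x - (t + ε) - (x - t) = -ε by ring, abs_neg, abs_of_pos hε]

end CuntzLemmas

/-! ### Cut-downs of `x* x + e`, and property (II) implies property (I) -/

section CutOff

variable {A : Type u} [NonUnitalCStarAlgebra A] [PartialOrder A] [StarOrderedRing A]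

/-- The element `(a - T)₊`, for `T ≥ 0`. -/
def cutOff (T : ℝ) (a : A) : A := cfcₙ (fun t : ℝ => max (t - T) 0) a

lemma cutOff_nonneg (T : ℝ) (a : A) : 0 ≤ cutOff T a := cfcₙ_nonneg fun _ _ => le_max_right _ _

lemma inr_cutOff {A : Type u} [NonUnitalCStarAlgebra A] {T : ℝ}
    (hT : 0 ≤ T) {a : A} (ha : IsSelfAdjoint a) :
    ((cutOff T a : A) : Unitization ℂ A) = ((a : Unitization ℂ A) - algebraMap ℝ _ T)⁺ := by
  have hsa : IsSelfAdjoint (a : Unitization ℂ A) := ha.inr _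
  rw [cutOff, Unitization.real_cfcₙ_eq_cfc_inr a _ (by simp [hT]), CFC.posPart_def, cfcₙ_eq_cfc]
  have h1 : (a : Unitization ℂ A) - algebraMap ℝ _ T = cfc (fun t : ℝ => t - T) (a : Unitization ℂ A) := by
    rw [cfc_sub (fun t : ℝ => t) (fun _ => T) (a : Unitization ℂ A), cfc_id' ℝ _ hsa, cfc_const T _ hsa]
  rw [h1, ← cfc_comp' (fun t : ℝ => t⁺) (fun t : ℝ => t - T) (a : Unitization ℂ A) (by fun_prop)
    (by fun_prop) hsa]
  rfl

/-- Uniqueness of the decomposition of a self-adjoint element into orthogonal positive and negative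
parts. It lets cut-downs be computed by exhibiting a decomposition. -/
lemma cutOff_eq_of_sub_eq {T : ℝ} (hT : 0 ≤ T) {a p : A} (ha : IsSelfAdjoint a) (hp : 0 ≤ p)
    {n : Unitization ℂ A} (hn : 0 ≤ n) (hpn : (p : Unitization ℂ A) * n = 0)
    (h : (a : Unitization ℂ A) - algebraMap ℝ _ T = p - n) : cutOff T a = p := by
  refine Unitization.inr_injective (R := ℂ) ?_
  rw [inr_cutOff hT ha]
  exact (CFC.posPart_negPart_unique h hpn (Unitization.inr_nonneg_iff.2 hp) hn).1

lemma exists_sub_eq_cutOff_sub {A : Type u} [NonUnitalCStarAlgebra A] {T : ℝ}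
    (hT : 0 ≤ T) {a : A} (ha : IsSelfAdjoint a) :
    ∃ n : Unitization ℂ A, 0 ≤ n ∧ ((cutOff T a : A) : Unitization ℂ A) * n = 0 ∧
      (a : Unitization ℂ A) - algebraMap ℝ _ T = ((cutOff T a : A) : Unitization ℂ A) - n := by
  have hsa : IsSelfAdjoint ((a : Unitization ℂ A) - algebraMap ℝ _ T) :=
    (ha.inr _).sub (.algebraMap _ (.all T))
  refine ⟨((a : Unitization ℂ A) - algebraMap ℝ _ T)⁻, CFC.negPart_nonneg _, ?_, ?_⟩
  · rw [inr_cutOff hT ha, CFC.posPart_mul_negPart]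
  · rw [inr_cutOff hT ha, CFC.posPart_sub_negPart _ hsa]

lemma homOfElement_e {a : A} (ha : 0 ≤ a) (ha1 : ‖a‖ ≤ 1) (t : ℝ≥0) :
    homOfElement a (C01.e t) = cutOff t a := by
  rw [C01.e, map_ofReal_eq_cfcₙ, homOfElement_ident ha ha1, cutOff]

lemma cuntzLE_cutOff_star_mul_self {x : A} (hx : ‖x‖ ≤ 1) (t : ℝ≥0) :
    CuntzLE (cutOff t (star x * x)) (cutOff t (x * star x)) := by
  have h0 : (0 : A) ≤ star x * x := star_mul_self_nonneg x
  have h0' : (0 : A) ≤ x * star x := mul_star_self_nonneg x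
  have h1 : ‖star x * x‖ ≤ 1 := by
    rw [CStarRing.norm_star_mul_self]; nlinarith [norm_nonneg x]
  have h1' : ‖x * star x‖ ≤ 1 := by
    rw [CStarRing.norm_self_mul_star]; nlinarith [norm_nonneg x]
  rw [← homOfElement_e h0 h1, ← homOfElement_e h0' h1']
  refine CuntzLE.of_stablyApproxUnitEquiv ?_ t
  rw [homOfElement_ident h0 h1, homOfElement_ident h0' h1']
  simpa using stablyApproxUnitEquiv_star_mul_self (star x)

variable {x e : A} {l : ℝ}

/-- Since `e` is a unit for `x* x`, it behaves like `1` there: `x* x + l e - T` is `x* x - (T - l)`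
minus `l (1 - e)`. The extra term is positive and orthogonal to the cut-down, so it only enlarges
the negative part. -/
lemma cutOff_star_mul_self_add_of_le (he : 0 ≤ e) (he1 : ‖e‖ ≤ 1) (hxe : x * e = x)
    (hl : 0 ≤ l) {T : ℝ} (hT : l ≤ T) :
    cutOff T (star x * x + l • e) = cutOff (T - l) (star x * x) := by
  have hq : IsSelfAdjoint (star x * x) := IsSelfAdjoint.star_mul_self x
  have hesa : star e = e := he.isSelfAdjoint
  obtain ⟨n, hn, hpn, h⟩ := exists_sub_eq_cutOff_sub (sub_nonneg.2 hT) hq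
  have he1' : (e : Unitization ℂ A) ≤ 1 := by
    have := (CStarAlgebra.norm_le_iff_le_algebraMap (e : Unitization ℂ A) zero_le_one
      (Unitization.inr_nonneg_iff.2 he)).1 (by rwa [Unitization.norm_inr])
    rwa [map_one] at this
  have hqe : star x * x * e = star x * x := by rw [mul_assoc, hxe]
  have heq : e * (star x * x) = star x * x := by
    rw [← mul_assoc, ← hesa, ← star_mul, hxe]
  have hpe : cutOff (T - l) (star x * x) * e = cutOff (T - l) (star x * x) :=
    (mul_cfcₙ_eq_of_mul_eq he.isSelfAdjoint heq hqe _).2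
  refine cutOff_eq_of_sub_eq (hl.trans hT) (hq.add ((IsSelfAdjoint.all l).smul he.isSelfAdjoint))
    (cutOff_nonneg _ _) (n := n + l • (1 - (e : Unitization ℂ A)))
    (add_nonneg hn (smul_nonneg hl (sub_nonneg.2 he1'))) ?_ ?_
  · rw [mul_add, hpn, mul_smul_comm, mul_sub, mul_one, ← Unitization.inr_mul, hpe, sub_self,
      smul_zero, add_zero]
  · rw [← sub_sub, ← h, Unitization.inr_add, Unitization.inr_smul, smul_sub, map_sub,
      ← Algebra.algebraMap_eq_smul_one]
    abel

lemma cutOff_star_mul_self_add_of_lt (he : 0 ≤ e)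
    (hxe : x * e = x) {T : ℝ} (hT0 : 0 ≤ T) (hT : T < l) :
    cutOff T (star x * x + l • e) = cutOff T (l • e) + star x * x ∧
      star x * x * cutOff T (l • e) = (l - T) • (star x * x) := by
  have hesa : IsSelfAdjoint (l • e) := (IsSelfAdjoint.all l).smul he.isSelfAdjoint
  obtain ⟨n, hn, hpn, h⟩ := exists_sub_eq_cutOff_sub hT0 hesa
  set p := cutOff T (l • e) with hp
  have hxT : (x : Unitization ℂ A) * (((l • e : A) : Unitization ℂ A) - algebraMap ℝ _ T) =
      (l - T) • (x : Unitization ℂ A) := by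
    rw [mul_sub, ← Unitization.inr_mul, mul_smul_comm, hxe, Unitization.inr_smul,
      Algebra.algebraMap_eq_smul_one, mul_smul_comm, mul_one, sub_smul]
  -- On `x`, the element `l e - T` acts as the positive scalar `l - T`, so its negative part `n`
  -- must annihilate `x`. Indeed, `y = x n` satisfies `(l - T) y y* = -y n y* ≤ 0`, which forces `y
  -- = 0`.
  have hxn : (x : Unitization ℂ A) * n = 0 := by
    set y := (x : Unitization ℂ A) * n with hy
    have h1 : (l - T) • y = -(y * n) := by
      rw [hy, ← smul_mul_assoc, ← hxT, h, mul_assoc, sub_mul, hpn, zero_sub, mul_neg, mul_assoc]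
    have h2 : (l - T) • (y * star y) = -(y * n * star y) := by
      rw [← smul_mul_assoc, h1, neg_mul]
    have h3 : 0 ≤ y * n * star y := star_right_conjugate_nonneg hn y
    have h4 : 0 ≤ (l - T) • (y * star y) := smul_nonneg (sub_nonneg.2 hT.le) (mul_star_self_nonneg y)
    have h5 : (l - T) • (y * star y) = 0 := le_antisymm (by rw [h2]; exact neg_nonpos.2 h3) h4
    have h6 : y * star y = 0 := (smul_eq_zero.1 h5).resolve_left (sub_pos.2 hT).ne'
    exact CStarRing.mul_star_self_eq_zero_iff _ |>.1 h6
  have hqn : ((star x * x : A) : Unitization ℂ A) * n = 0 := by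
    rw [Unitization.inr_mul, mul_assoc, hxn, mul_zero]
  constructor
  · refine cutOff_eq_of_sub_eq hT0 ((IsSelfAdjoint.star_mul_self x).add hesa)
      (add_nonneg (cutOff_nonneg _ _) (star_mul_self_nonneg x)) hn ?_ ?_
    · rw [Unitization.inr_add, add_mul, hpn, hqn, add_zero]
    · rw [Unitization.inr_add, Unitization.inr_add, add_sub_assoc, h]; abel
  · refine Unitization.inr_injective (R := ℂ) ?_
    have h7 : (x : Unitization ℂ A) * p = (l - T) • (x : Unitization ℂ A) := by
      rw [← hxT, h, mul_sub, hxn, sub_zero]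
    rw [Unitization.inr_mul, Unitization.inr_mul, mul_assoc, h7, mul_smul_comm, Unitization.inr_smul,
      Unitization.inr_mul]

lemma mul_self_le_norm_smul {p : A} (hp : 0 ≤ p) : p * p ≤ ‖p‖ • p := by
  have h1 := CStarAlgebra.star_right_conjugate_le_norm_smul (a := CFC.sqrt p) (b := p) hp.isSelfAdjoint
  have h2 : star (CFC.sqrt p) = CFC.sqrt p := (CFC.sqrt_nonneg _).isSelfAdjoint
  have h3 := CFC.sqrt_mul_sqrt_self p hp
  rw [h2, h3] at h1
  have h4 : CFC.sqrt p * p * CFC.sqrt p = p * p := by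
    calc _ = CFC.sqrt p * (CFC.sqrt p * CFC.sqrt p) * CFC.sqrt p := by rw [h3]
      _ = (CFC.sqrt p * CFC.sqrt p) * (CFC.sqrt p * CFC.sqrt p) := by simp only [mul_assoc]
      _ = _ := by rw [h3]
  rwa [h4] at h1

/-- `μ² q = p q p ≤ ‖q‖ p² ≤ ‖q‖ ‖p‖ p`. -/
lemma le_smul_of_mul_eq_smul {p q : A} (hp : 0 ≤ p) (hq : 0 ≤ q) {μ : ℝ} (hμ : 0 < μ)
    (h : q * p = μ • q) : q ≤ ((μ⁻¹ * μ⁻¹) * (‖q‖ * ‖p‖)) • p := by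
  have hpq : p * q = μ • q := by
    have := congrArg star h
    rwa [star_mul, star_smul, hp.isSelfAdjoint.star_eq, hq.isSelfAdjoint.star_eq, star_trivial] at this
  have h1 : p * q * p = (μ * μ) • q := by
    rw [hpq, smul_mul_assoc, h, smul_smul]
  have h2 := CStarAlgebra.star_right_conjugate_le_norm_smul (a := p) (b := q) hq.isSelfAdjoint
  rw [hp.isSelfAdjoint.star_eq, h1] at h2
  have h3 : (μ * μ) • q ≤ (‖q‖ * ‖p‖) • p := by
    rw [mul_smul ‖q‖ ‖p‖]
    exact h2.trans (smul_le_smul_of_nonneg_left (mul_self_le_norm_smul hp) (norm_nonneg _))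
  have h4 := smul_le_smul_of_nonneg_left h3 (show 0 ≤ μ⁻¹ * μ⁻¹ by positivity)
  rw [smul_smul, smul_smul] at h4
  have h5 : μ⁻¹ * μ⁻¹ * (μ * μ) = 1 := by field_simp
  rwa [h5, one_smul] at h4

/-- For `t ≥ l` the cut-downs are those of `x* x` and `x x*` at `t - l`, which are comparable by
stable unitary equivalence. For `t < l` the summand `x* x` is dominated by a multiple of `(l e -
t)₊`, which is common to both sides. -/
theorem cuntzLE_cutOff_add (he : 0 ≤ e) (he1 : ‖e‖ ≤ 1) (hex : e * x = x) (hxe : x * e = x)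
    (hl : 0 ≤ l) (hx : ‖x‖ ≤ 1) (t : ℝ≥0) :
    CuntzLE (cutOff t (star x * x + l • e)) (cutOff t (x * star x + l • e)) := by
  have hxe' : star x * e = star x := by
    have := congrArg star hex; rwa [star_mul, he.isSelfAdjoint.star_eq] at this
  rcases le_or_gt l t with ht | ht
  · have h1 := cutOff_star_mul_self_add_of_le he he1 hxe hl ht
    have h2 := cutOff_star_mul_self_add_of_le he he1 hxe' hl ht
    rw [star_star] at h2
    rw [h1, h2]
    exact cuntzLE_cutOff_star_mul_self hx ⟨t - l, sub_nonneg.2 ht⟩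
  · obtain ⟨h1, h3⟩ := cutOff_star_mul_self_add_of_lt he hxe t.2 ht
    obtain ⟨h2, -⟩ := cutOff_star_mul_self_add_of_lt he hxe' t.2 ht
    rw [star_star] at h2
    have h1' : cutOff t (star x * x + l • e) = cutOff t (l • e) + star x * x := h1
    have h2' : cutOff t (x * star x + l • e) = cutOff t (l • e) + x * star x := h2
    rw [h1', h2']
    set p := cutOff (t : ℝ) (l • e)
    have hp : 0 ≤ p := cutOff_nonneg _ _
    have hq : 0 ≤ star x * x := star_mul_self_nonneg x
    have hq' : 0 ≤ x * star x := mul_star_self_nonneg x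
    have h4 := le_smul_of_mul_eq_smul hp hq (sub_pos.2 ht) h3
    set C := ((l - t)⁻¹ * (l - t)⁻¹) * (‖star x * x‖ * ‖p‖)
    have hC : 0 ≤ C := by
      have := sub_pos.2 ht
      positivity
    refine CuntzLE.of_le_smul (C := 1 + C) (add_nonneg hp hq) (add_nonneg hp hq') (by positivity) ?_
    calc p + star x * x ≤ p + C • p := by gcongr
      _ = (1 + C) • p := by rw [add_smul, one_smul]
      _ ≤ (1 + C) • (p + x * star x) := by
        refine smul_le_smul_of_nonneg_left (le_add_of_nonneg_right hq') (by positivity)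

theorem PropertyII.propertyI (hII : PropertyII A) : PropertyI A := by
  intro x e he he1 hex hxe
  -- Since `‖x* x + e‖` and `‖x x* + e‖` are at most `‖x‖² + 1`, scaling by `l` yields contractions,
  -- so that they are the images of `id` under homomorphisms. The scaling is undone at the end.
  set l : ℝ := (‖x‖ ^ 2 + 1)⁻¹ with hl
  have hM : 0 < ‖x‖ ^ 2 + 1 := by positivity
  have hl0 : 0 < l := inv_pos.2 hM
  have hll : √l * √l = l := Real.mul_self_sqrt hl0.le
  have hlx : l * (‖x‖ ^ 2 + 1) = 1 := inv_mul_cancel₀ hM.ne'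
  set y : A := √l • x with hy
  have hy1 : ‖y‖ ≤ 1 := by
    have : ‖y‖ * ‖y‖ ≤ 1 := by
      rw [hy, norm_smul, Real.norm_of_nonneg (Real.sqrt_nonneg _)]
      nlinarith
    nlinarith [norm_nonneg y]
  have hey : e * y = y := by rw [hy, mul_smul_comm, hex]
  have hye : y * e = y := by rw [hy, smul_mul_assoc, hxe]
  have hey' : e * star y = star y := by
    have := congrArg star hye; rwa [star_mul, he.isSelfAdjoint.star_eq] at this
  have hye' : star y * e = star y := by
    have := congrArg star hey; rwa [star_mul, he.isSelfAdjoint.star_eq] at this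
  set a := star y * y + l • e with ha
  set b := y * star y + l • e with hb
  have ha_eq : a = l • (star x * x + e) := by
    rw [ha, hy, star_smul, smul_mul_smul_comm, star_trivial, hll, smul_add]
  have hb_eq : b = l • (x * star x + e) := by
    rw [hb, hy, star_smul, smul_mul_smul_comm, star_trivial, hll, smul_add]
  have ha0 : 0 ≤ a := add_nonneg (star_mul_self_nonneg y) (smul_nonneg hl0.le he)
  have hb0 : 0 ≤ b := add_nonneg (mul_star_self_nonneg y) (smul_nonneg hl0.le he)
  have ha1 : ‖a‖ ≤ 1 := by
    rw [ha_eq, norm_smul, Real.norm_of_nonneg hl0.le, ← hlx]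
    gcongr
    refine (norm_add_le _ _).trans ?_
    rw [CStarRing.norm_star_mul_self]
    nlinarith
  have hb1 : ‖b‖ ≤ 1 := by
    rw [hb_eq, norm_smul, Real.norm_of_nonneg hl0.le, ← hlx]
    gcongr
    refine (norm_add_le _ _).trans ?_
    rw [CStarRing.norm_self_mul_star]
    nlinarith
  have hdW : dW (Cu.map (homOfElement a)) (Cu.map (homOfElement b)) = 0 := by
    rw [dW, NNReal.coe_eq_zero]
    refine le_antisymm (csInf_le (OrderBot.bddBelow _) fun t => ?_) zero_le
    rw [Cu.map_cuE_le_iff, Cu.map_cuE_le_iff, add_zero, homOfElement_e ha0 ha1,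
      homOfElement_e hb0 hb1]
    refine ⟨cuntzLE_cutOff_add he he1 hey hye hl0.le hy1 t, ?_⟩
    have := cuntzLE_cutOff_add he he1 hey' hye' hl0.le (by rwa [norm_star]) t
    rwa [star_star] at this
  obtain ⟨u, hu⟩ := hII _ _ hdW
  have hab : StablyApproxUnitEquiv a b := by
    refine ⟨fun n => star (u n), ?_⟩
    have := hu C01.ident
    rw [homOfElement_ident ha0 ha1, homOfElement_ident hb0 hb1] at this
    simpa using this
  have := hab.smul ((‖x‖ ^ 2 + 1 : ℝ) : ℂ)
  rwa [ha_eq, hb_eq, Complex.coe_smul, Complex.coe_smul, smul_smul, smul_smul, mul_comm, hlx,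
    one_smul, one_smul] at this

end CutOff

end StableCu

end

open StableCu in
theorem theorem1 {A : Type*} [NonUnitalCStarAlgebra A] [PartialOrder A] [StarOrderedRing A] :
    (PropertyI A ↔ PropertyII A) ∧
      (PropertyI A ∧ PropertyII A → ∀ φ ψ : C01 →⋆ₙₐ[ℂ] A,
        dW (Cu.map φ) (Cu.map ψ) ≤ dU (φ C01.ident) (ψ C01.ident) ∧
          dU (φ C01.ident) (ψ C01.ident) ≤ 4 * dW (Cu.map φ) (Cu.map ψ)) := by
  refine ⟨⟨fun h => h.propertyII, fun h => h.propertyI⟩, fun ⟨hI, _⟩ φ ψ =>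
    ⟨dW_le_dU φ ψ, (hI.dU_le_dW φ ψ).trans ?_⟩⟩
  have : 0 ≤ dW (Cu.map φ) (Cu.map ψ) := NNReal.coe_nonneg _
  linarith
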